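/- Let $\mathtt{Gr}$ be one of the following three classes of (finite) directed graphs with half-edges and without directed cycles, with ordered inputs and outputs of the graph and of each vertex: all of them, the connected ones, or the simply connected ones. (Exceptional edges, i.e. edges without an end vertex, are allowed; the empty graph is not connected.) For a set of colors $\mathfrak C$, a biprofile $(\underline c;\underline d)$ is a pair of finite lists of colors. A simplicial $\mathtt{Gr}$-prop $\mathcal P$ (a simplicial prop, properad or dioperad, respectively) consists of a set of colors $\mathrm{col}(\mathcal P)$, a simplicial set $\mathcal P\binom{\underline d}{\underline c}$ for each biprofile, and composition maps $\gamma_G\colon \prod_{v}\mathcal P\binom{\mathrm{out}(v)}{\mathrm{in}(v)}\to\mathcal P\binom{\mathrm{out}(G)}{\mathrm{in}(G)}$ for all colored graphs $G\in\mathtt{Gr}$, which are compatible with graph substitution and for which $\gamma$ of a standard corolla is the identity; the units are the compositions along the exceptional edges. A morphism $f\colon\mathcal P\to\mathcal Q$ is a map of color sets together with maps $\mathcal P\binom{\underline d}{\underline c}\to\mathcal Q\binom{f\underline d}{f\underline c}$ compatible with all compositions and units. Let $\mathbf N$ be the category of simplicial $\mathtt{Gr}$-props. Let $U_1\colon\mathbf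 N\to\mathbf{sCat}$ be the forgetful functor to small simplicially enriched categories, with $\mathrm{Ob}(U_1\mathcal P)=\mathrm{col}(\mathcal P)$ and $(U_1\mathcal P)(a,b)=\mathcal P\binom{b}{a}$. Let $\mathcal W_{\mathbf{sCat}}$ be the class of functors of simplicial categories which are weak homotopy equivalences on all simplicial sets of morphisms and induce an equivalence of categories of components $\pi_0$. Let $\mathcal L$ be the class of local equivalences, i.e. of the morphisms $f\colon\mathcal P\to\mathcal Q$ of $\mathbf N$ such that $\mathcal P\binom{\underline d}{\underline c}\to\mathcal Q\binom{f\underline d}{f\underline c}$ is a weak homotopy equivalence of simplicial sets for every biprofile $(\underline c;\underline d)$ of $\mathcal P$. Put $$\mathcal W_{\mathbf N}=(U_1^{-1}\mathcal W_{\mathbf{sCat}})\cap\mathcal L .$$ **Theorem.** Let $\mathcal P\xrightarrow{g}\mathcal Q\xrightarrow{f}\mathcal R$ be morphisms of $\mathbf N$. If $g$ and $f\circ g$ are in $\mathcal W_{\mathbf N}$, then so is $f$. Consequently, $\mathcal W_{\mathbf N}$ has the two-out-of-three property and is closed under retracts. In contrast, $\mathcal L$ does not have the two-out-of-three property. -/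

import Mathlib

/-! ## Weak homotopy equivalences of simplicial sets -/

open CategoryTheory MonoidalCategory Opposite

universe u v

/-- A map `f : X ⟶ Y` of simplicial sets is a weak homotopy equivalence if for every Kan complex `Z`
precomposition with `f` induces a bijection `π₀ (Fun(Y, Z)) → π₀ (Fun(X, Z))`. -/
def SSet.weakHomotopyEquivalences : MorphismProperty SSet.{v} := fun _ _ f =>
  ∀ Z : SSet.{v}, SSet.KanComplex Z →
    Function.Bijective (SSet.mapπ₀ ((MonoidalClosed.pre f).app Z))

/-! ## Simplicial categories -/

/-- A small simplicially enriched category. -/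
structure SCat : Type (max (u + 1) (v + 1)) where
  /-- the type of objects -/
  Obj : Type u
  /-- the simplicial enrichment -/
  [enriched : EnrichedCategory SSet.{v} Obj]

section

open scoped Simplicial

namespace SCat

attribute [instance] SCat.enriched

/-- Morphisms of simplicial categories are simplicially enriched functors. -/
instance : Category SCat.{u, v} where
  Hom C D := EnrichedFunctor SSet.{v} C.Obj D.Obj
  id C := EnrichedFunctor.id SSet C.Obj
  comp F G := EnrichedFunctor.comp SSet F G
  id_comp F := by cases F; simp [EnrichedFunctor.comp, EnrichedFunctor.id]
  comp_id F := by cases F; simp [EnrichedFunctor.comp, EnrichedFunctor.id]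
  assoc F G H := by simp [EnrichedFunctor.comp]

/-- The comparison map `π₀ X × π₀ Y → π₀ (X × Y)`. -/
def piZeroPair {X Y : SSet.{v}} (x : SSet.π₀ X) (y : SSet.π₀ Y) : SSet.π₀ (X ⊗ Y) :=
  SSet.π₀.lift (fun a => SSet.π₀.lift (fun b => SSet.π₀.mk ((a, b) : (X ⊗ Y : SSet.{v}) _⦋0⦌))
    (fun b₀ b₁ e => SSet.π₀.sound (SSet.Edge.mk
      (((SSet.Edge.id a).edge, e.edge) : (X ⊗ Y : SSet.{v}) _⦋1⦌)
      (Prod.ext (SSet.Edge.id a).src_eq e.src_eq) (Prod.ext (SSet.Edge.id a).tgt_eq e.tgt_eq))) y)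
    (fun a₀ a₁ e => by
      induction y with
      | mk b =>
        exact SSet.π₀.sound (SSet.Edge.mk
          ((e.edge, (SSet.Edge.id b).edge) : (X ⊗ Y : SSet.{v}) _⦋1⦌)
          (Prod.ext e.src_eq (SSet.Edge.id b).src_eq) (Prod.ext e.tgt_eq (SSet.Edge.id b).tgt_eq)))
    x

/-- The objects of the category of components of a simplicial category. -/
structure PiZero (C : SCat.{u, v}) : Type u where
  /-- the underlying object -/
  as : C.Obj

/-- The category of components of a simplicial category `C`: it has the objects of `C`, and the
morphisms from `a` to `b` are the connected components of the simplicial set `C(a, b)`. -/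
instance (C : SCat.{u, v}) : Category.{v} (PiZero C) where
  Hom a b := SSet.π₀ (a.as ⟶[SSet.{v}] b.as)
  id a := SSet.π₀.mk ((eId SSet.{v} a.as).app (op ⦋0⦌) PUnit.unit)
  comp {a b c} f g := SSet.mapπ₀ (eComp SSet.{v} a.as b.as c.as) (piZeroPair f g)
  id_comp {a b} f := by
    induction f with
    | mk x =>
      exact congrArg SSet.π₀.mk
        (ConcreteCategory.congr_hom (NatTrans.congr_app (e_id_comp SSet.{v} a.as b.as) (op ⦋0⦌)) x)
  comp_id {a b} f := by
    induction f with
    | mk x =>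
      exact congrArg SSet.π₀.mk
        (ConcreteCategory.congr_hom (NatTrans.congr_app (e_comp_id SSet.{v} a.as b.as) (op ⦋0⦌)) x)
  assoc {a b c d} f g h := by
    obtain ⟨x, rfl⟩ := SSet.π₀.mk_surjective f
    obtain ⟨y, rfl⟩ := SSet.π₀.mk_surjective g
    obtain ⟨z, rfl⟩ := SSet.π₀.mk_surjective h
    have H := NatTrans.congr_app (e_assoc SSet.{v} a.as b.as c.as d.as) (op ⦋0⦌)
    let p : ((a.as ⟶[SSet.{v}] b.as) ⊗ ((b.as ⟶[SSet.{v}] c.as) ⊗ (c.as ⟶[SSet.{v}] d.as)) :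
      SSet.{v}) _⦋0⦌ := (x, (y, z))
    have h := ConcreteCategory.congr_hom H p
    exact congrArg SSet.π₀.mk h

/-- The functor on categories of components induced by a functor of simplicial categories. -/
def piZeroMap {C D : SCat.{u, v}} (F : C ⟶ D) : PiZero C ⥤ PiZero D where
  obj a := ⟨EnrichedFunctor.obj F a.as⟩
  map {a b} f := SSet.mapπ₀ (EnrichedFunctor.map F a.as b.as) f
  map_id a := congrArg SSet.π₀.mk (ConcreteCategory.congr_hom
    (NatTrans.congr_app (EnrichedFunctor.map_id F a.as) (op ⦋0⦌)) PUnit.unit)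
  map_comp {a b c} f g := by
    obtain ⟨x, rfl⟩ := SSet.π₀.mk_surjective f
    obtain ⟨y, rfl⟩ := SSet.π₀.mk_surjective g
    have H := NatTrans.congr_app (EnrichedFunctor.map_comp F a.as b.as c.as) (op ⦋0⦌)
    let p : ((a.as ⟶[SSet.{v}] b.as) ⊗ (b.as ⟶[SSet.{v}] c.as) : SSet.{v}) _⦋0⦌ := (x, y)
    have h := ConcreteCategory.congr_hom H p
    exact congrArg SSet.π₀.mk h

/-- The weak equivalences of simplicial categories (Dwyer-Kan equivalences): the functors which are
weak homotopy equivalences on all simplicial sets of morphisms and induce an equivalence between the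
categories of components. -/
def weakEquivalences : MorphismProperty SCat.{u, v} := fun C _ F =>
  (∀ a b : C.Obj, SSet.weakHomotopyEquivalences (EnrichedFunctor.map F a b)) ∧
    (piZeroMap F).IsEquivalence

end SCat

end

/-! ## Colored graphs -/

/-- A profile in a set of colors `C`: a finite ordered list of colors. -/
structure Profile (C : Type u) : Type u where
  /-- the length of the list -/
  len : ℕ
  /-- the entries of the list -/
  col : Fin len → C

namespace Profile

/-- The profile with a single entry. -/
def single {C : Type u} (a : C) : Profile C := ⟨1, fun _ => a⟩

/-- Apply a map of colors to all entries of a profile. -/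
def map {C D : Type u} (f : C → D) (c : Profile C) : Profile D := ⟨c.len, f ∘ c.col⟩

end Profile

/-- A `C`-colored directed graph without directed cycles, with set of vertices `V`, in which the
vertex `v` has the input profile `s v` and the output profile `t v`, and whose input and output
profiles are `c` and `d`.

Every edge starts at exactly one place, which is either a graph input or an output of a vertex, and
ends at exactly one place, which is either a graph output or an input of a vertex; an edge may be
both a graph input and a graph output. The orderings of the inputs and outputs of the graph and of
its vertices are recorded by enumerating these edges. -/
structure ColoredGraph {C : Type u} {V : Type} (s t : V → Profile C) (c d : Profile C) where
  /-- the set of edges -/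
  Edge : Type
  /-- the coloring of the edges -/
  color : Edge → C
  /-- the ordered list of inputs of the graph -/
  inp : Fin c.len → Edge
  /-- the ordered list of outputs of the graph -/
  out : Fin d.len → Edge
  /-- the ordered list of inputs of each vertex -/
  vinp : ∀ v, Fin (s v).len → Edge
  /-- the ordered list of outputs of each vertex -/
  vout : ∀ v, Fin (t v).len → Edge
  color_inp : ∀ i, color (inp i) = c.col i
  color_out : ∀ i, color (out i) = d.col i
  color_vinp : ∀ v i, color (vinp v i) = (s v).col i
  color_vout : ∀ v i, color (vout v i) = (t v).col i
  source_bijective : Function.Bijective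
    (Sum.elim inp fun p : Σ v, Fin (t v).len => vout p.1 p.2)
  target_bijective : Function.Bijective
    (Sum.elim out fun p : Σ v, Fin (s v).len => vinp p.1 p.2)
  acyclic : ∀ v, ¬ Relation.TransGen (fun v w => ∃ j i, vout v j = vinp w i) v v

namespace ColoredGraph

variable {C D : Type u} {V : Type} {s t : V → Profile C} {c d : Profile C}

/-- The vertex `v` is an end of the edge `e`. -/
def Incident (G : ColoredGraph s t c d) (v : V) (e : G.Edge) : Prop :=
  (∃ i, G.vinp v i = e) ∨ ∃ j, G.vout v j = e

/-- The undirected bipartite graph on the vertices and edges of `G`, in which a vertex is joined to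
the edges at it. It is the barycentric subdivision of the undirected graph underlying `G`. -/
def incidence (G : ColoredGraph s t c d) : SimpleGraph (V ⊕ G.Edge) where
  Adj x y := match x, y with
    | .inl v, .inr e => G.Incident v e
    | .inr e, .inl v => G.Incident v e
    | _, _ => False
  symm := ⟨by rintro (v | e) (w | e') h <;> exact h⟩
  loopless := ⟨by rintro (v | e) h <;> exact h⟩

/-- Apply a map of colors to all edges of a graph. -/
def mapColor (f : C → D) (G : ColoredGraph s t c d) :
    ColoredGraph (fun v => (s v).map f) (fun v => (t v).map f) (c.map f) (d.map f) where
  Edge := G.Edge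
  color := f ∘ G.color
  inp := G.inp
  out := G.out
  vinp := G.vinp
  vout := G.vout
  color_inp i := congrArg f (G.color_inp i)
  color_out i := congrArg f (G.color_out i)
  color_vinp v i := congrArg f (G.color_vinp v i)
  color_vout v i := congrArg f (G.color_vout v i)
  source_bijective := G.source_bijective
  target_bijective := G.target_bijective
  acyclic := G.acyclic

/-- The standard corolla: one vertex, whose inputs and outputs are those of the graph. -/
def corolla (c d : Profile C) : ColoredGraph (fun _ : Unit => c) (fun _ : Unit => d) c d where
  Edge := Fin c.len ⊕ Fin d.len
  color := Sum.elim c.col d.col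
  inp := Sum.inl
  out := Sum.inr
  vinp _ := Sum.inl
  vout _ := Sum.inr
  color_inp _ := rfl
  color_out _ := rfl
  color_vinp _ _ := rfl
  color_vout _ _ := rfl
  source_bijective := by
    refine ⟨?_, ?_⟩
    · rintro (i | ⟨v, i⟩) (j | ⟨w, j⟩) h <;> simp_all
    · rintro (i | i)
      exacts [⟨.inl i, rfl⟩, ⟨.inr ⟨(), i⟩, rfl⟩]
  target_bijective := by
    refine ⟨?_, ?_⟩
    · rintro (i | ⟨v, i⟩) (j | ⟨w, j⟩) h <;> simp_all
    · rintro (i | i)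
      exacts [⟨.inr ⟨(), i⟩, rfl⟩, ⟨.inl i, rfl⟩]
  acyclic v h := by
    obtain ⟨w, -, j, i, h⟩ := Relation.TransGen.tail'_iff.1 h
    simp at h

/-- The exceptional edge of color `a`: a graph with no vertices and one edge, which is both the input
and the output of the graph. -/
def exceptional [IsEmpty V] (s t : V → Profile C) (a : C) :
    ColoredGraph s t (Profile.single a) (Profile.single a) where
  Edge := Unit
  color _ := a
  inp _ := ()
  out _ := ()
  vinp v := isEmptyElim v
  vout v := isEmptyElim v
  color_inp _ := rfl
  color_out _ := rfl
  color_vinp v := isEmptyElim v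
  color_vout v := isEmptyElim v
  source_bijective := by
    refine ⟨?_, fun _ => ⟨.inl (0 : Fin 1), rfl⟩⟩
    rintro (i | ⟨v, i⟩) (j | ⟨w, j⟩) h
    · exact congrArg _ (Subsingleton.elim (α := Fin 1) _ _)
    · exact (IsEmpty.false w).elim
    · exact (IsEmpty.false v).elim
    · exact (IsEmpty.false v).elim
  target_bijective := by
    refine ⟨?_, fun _ => ⟨.inl (0 : Fin 1), rfl⟩⟩
    rintro (i | ⟨v, i⟩) (j | ⟨w, j⟩) h
    · exact congrArg _ (Subsingleton.elim (α := Fin 1) _ _)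
    · exact (IsEmpty.false w).elim
    · exact (IsEmpty.false v).elim
    · exact (IsEmpty.false v).elim
  acyclic v := isEmptyElim v

/-- The linear graph with `n` vertices, each with one input and one output, whose consecutive edges
have the colors `a 0, a 1, …, a n`. -/
def linear (n : ℕ) (a : Fin (n + 1) → C) :
    ColoredGraph (fun k : Fin n => Profile.single (a k.castSucc))
      (fun k : Fin n => Profile.single (a k.succ))
      (Profile.single (a 0)) (Profile.single (a (Fin.last n))) where
  Edge := Fin (n + 1)
  color := a
  inp _ := 0
  out _ := Fin.last n
  vinp k _ := k.castSucc
  vout k _ := k.succ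
  color_inp _ := rfl
  color_out _ := rfl
  color_vinp _ _ := rfl
  color_vout _ _ := rfl
  source_bijective := by
    refine ⟨?_, ?_⟩
    · rintro (i | ⟨v, i⟩) (j | ⟨w, j⟩) h
      · exact congrArg _ (Subsingleton.elim (α := Fin 1) _ _)
      · exact absurd h.symm (Fin.succ_ne_zero w)
      · exact absurd h (Fin.succ_ne_zero v)
      · obtain rfl : v = w := Fin.succ_injective _ h
        obtain rfl : i = j := Subsingleton.elim (α := Fin 1) _ _
        rfl
    · intro k
      rcases Fin.eq_zero_or_eq_succ k with rfl | ⟨k, rfl⟩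
      · exact ⟨.inl (0 : Fin 1), rfl⟩
      · exact ⟨.inr ⟨k, (0 : Fin 1)⟩, rfl⟩
  target_bijective := by
    refine ⟨?_, ?_⟩
    · rintro (i | ⟨v, i⟩) (j | ⟨w, j⟩) h
      · exact congrArg _ (Subsingleton.elim (α := Fin 1) _ _)
      · exact absurd h.symm (Fin.castSucc_ne_last w)
      · exact absurd h (Fin.castSucc_ne_last v)
      · obtain rfl : v = w := Fin.castSucc_injective _ h
        obtain rfl : i = j := Subsingleton.elim (α := Fin 1) _ _
        rfl
    · intro k
      rcases Fin.eq_castSucc_or_eq_last k with ⟨k, rfl⟩ | rfl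
      · exact ⟨.inr ⟨k, (0 : Fin 1)⟩, rfl⟩
      · exact ⟨.inl (0 : Fin 1), rfl⟩
  acyclic v h := by
    have key : ∀ w, Relation.TransGen
        (fun v w : Fin n => ∃ (_ _ : Fin 1), v.succ = w.castSucc) v w → v < w := by
      intro w hw
      induction hw with
      | single h =>
        obtain ⟨-, -, h⟩ := h
        rw [Fin.ext_iff] at h
        simp only [Fin.val_succ, Fin.val_castSucc] at h
        rw [Fin.lt_def]; omega
      | tail _ h ih =>
        obtain ⟨-, -, h⟩ := h
        rw [Fin.ext_iff] at h
        simp only [Fin.val_succ, Fin.val_castSucc] at h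
        rw [Fin.lt_def] at ih ⊢; omega
    exact lt_irrefl _ (key v h)

/-- A simple graph is acyclic if it has a height function such that every vertex has at most one
neighbor which is not strictly higher. -/
theorem isAcyclic_of_height {X : Type*} (Γ : SimpleGraph X) (h : X → ℕ)
    (hh : ∀ x y z, Γ.Adj x y → Γ.Adj x z → h y ≤ h x → h z ≤ h x → y = z) : Γ.IsAcyclic := by
  classical
  intro x p hp
  obtain ⟨y, hy, hmax⟩ := p.support.toFinset.exists_max_image h
    ⟨x, by simp⟩
  rw [List.mem_toFinset] at hy
  have hq := hp.rotate hy
  have hnil := hq.not_nil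
  have hle : ∀ z ∈ (p.rotate y hy).support, h z ≤ h y := fun z hz =>
    hmax z (by rw [List.mem_toFinset]; simpa using hz)
  exact hq.snd_ne_penultimate (hh y _ _ ((p.rotate y hy).adj_snd hnil)
    ((p.rotate y hy).adj_penultimate hnil).symm
    (hle _ ((p.rotate y hy).getVert_mem_support _)) (hle _ ((p.rotate y hy).getVert_mem_support _)))

theorem corolla_isTree (c d : Profile C) : (corolla c d).incidence.IsTree := by
  have hadj : ∀ e, (corolla c d).incidence.Adj (.inl ()) (.inr e) := by
    rintro (i | i)
    exacts [.inl ⟨i, rfl⟩, .inr ⟨i, rfl⟩]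
  refine ⟨?_, isAcyclic_of_height _ (Sum.elim (fun _ => 0) fun _ => 1) ?_⟩
  · rw [SimpleGraph.connected_iff_exists_forall_reachable]
    refine ⟨.inl (), ?_⟩
    rintro (_ | e)
    exacts [.refl _, (hadj e).reachable]
  · rintro (_ | e) (_ | e') (_ | e'') h h' h1 h2 <;> simp_all [incidence]

theorem exceptional_isTree [IsEmpty V] (s t : V → Profile C) (a : C) :
    (exceptional s t a).incidence.IsTree := by
  have : Nonempty (V ⊕ (exceptional s t a).Edge) := ⟨.inr ()⟩
  have : Subsingleton (V ⊕ (exceptional s t a).Edge) := by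
    refine ⟨?_⟩
    rintro (v | e) (w | e')
    · exact isEmptyElim v
    · exact isEmptyElim v
    · exact isEmptyElim w
    · rfl
  exact .of_subsingleton

theorem linear_isTree (n : ℕ) (a : Fin (n + 1) → C) :
    (linear n a).incidence.IsTree := by
  have h1 : ∀ k : Fin n, (linear n a).incidence.Adj (.inl k) (.inr k.castSucc) :=
    fun k => .inl ⟨(0 : Fin 1), rfl⟩
  have h2 : ∀ k : Fin n, (linear n a).incidence.Adj (.inl k) (.inr k.succ) :=
    fun k => .inr ⟨(0 : Fin 1), rfl⟩
  have inc : ∀ (k : Fin n) (e : Fin (n + 1)), (linear n a).Incident k e →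
      (e : ℕ) = k ∨ (e : ℕ) = k + 1 := by
    rintro k e (⟨_, rfl⟩ | ⟨_, rfl⟩)
    exacts [.inl rfl, .inr rfl]
  refine ⟨?_, isAcyclic_of_height _
    (Sum.elim (fun k : Fin n => 2 * (k : ℕ) + 1) fun k : Fin (n + 1) => 2 * (k : ℕ)) ?_⟩
  · rw [SimpleGraph.connected_iff_exists_forall_reachable]
    have h3 : ∀ k : Fin (n + 1),
        (linear n a).incidence.Reachable (.inr (0 : Fin (n + 1))) (.inr k) := by
      intro k
      induction k using Fin.induction with
      | zero => exact .refl _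
      | succ k ih => exact (ih.trans (h1 k).symm.reachable).trans (h2 k).reachable
    refine ⟨.inr (0 : Fin (n + 1)), ?_⟩
    rintro (k | e)
    exacts [(h3 _).trans (h1 k).symm.reachable, h3 e]
  · rintro (k | k) (l | l) (m | m) h h' hl hm
    all_goals first | exact h.elim | exact h'.elim | skip
    · have := inc _ _ h
      have := inc _ _ h'
      replace hl : 2 * Fin.val (n := n + 1) l ≤ 2 * (k : ℕ) + 1 := hl
      replace hm : 2 * Fin.val (n := n + 1) m ≤ 2 * (k : ℕ) + 1 := hm
      exact congrArg Sum.inr (Fin.ext (by omega))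
    · have := inc _ _ h
      have := inc _ _ h'
      replace hl : 2 * (l : ℕ) + 1 ≤ 2 * Fin.val (n := n + 1) k := hl
      replace hm : 2 * (m : ℕ) + 1 ≤ 2 * Fin.val (n := n + 1) k := hm
      exact congrArg Sum.inl (Fin.ext (by omega))

/-- The data exhibiting `K` as the result of substituting the graphs `H v` for the vertices `v` of
`G`. The vertices of `K` are those of the graphs `H v`, via a bijection `ι`, with the same orderings
of inputs and outputs. The edges of `K` are those of `G` and of the graphs `H v`, where the `i`-th
input (output) of `H v` is glued to the edge of `G` which is the `i`-th input (output) of `v`. (As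
every edge of `K` starts at exactly one place, no further edges are identified and there are no
others.) The graph inputs and outputs of `K` are those of `G`. -/
structure Substitution {U : Type} {W : V → Type} (ι : ∀ v, W v → U) {a b : U → Profile C}
    (G : ColoredGraph s t c d)
    (H : ∀ v, ColoredGraph (fun w => a (ι v w)) (fun w => b (ι v w)) (s v) (t v))
    (K : ColoredGraph a b c d) where
  bijective : Function.Bijective fun p : Σ v, W v => ι p.1 p.2
  /-- the map from the edges of `G` to those of `K` -/
  outer : G.Edge → K.Edge
  /-- the map from the edges of `H v` to those of `K` -/
  inner : ∀ v, (H v).Edge → K.Edge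
  color_outer : ∀ e, K.color (outer e) = G.color e
  color_inner : ∀ v e, K.color (inner v e) = (H v).color e
  glue_inp : ∀ v i, inner v ((H v).inp i) = outer (G.vinp v i)
  glue_out : ∀ v j, inner v ((H v).out j) = outer (G.vout v j)
  inp_eq : ∀ i, K.inp i = outer (G.inp i)
  out_eq : ∀ j, K.out j = outer (G.out j)
  vinp_eq : ∀ v w i, K.vinp (ι v w) i = inner v ((H v).vinp w i)
  vout_eq : ∀ v w j, K.vout (ι v w) j = inner v ((H v).vout w j)

end ColoredGraph

/-- The three graph groupoids under consideration: all directed graphs without directed cycles, the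
connected ones, and the simply connected ones. -/
inductive GraphGroupoid : Type
  | wheelFree
  | connected
  | simplyConnected

/-- Membership of a colored graph in a graph groupoid. The empty graph is not connected. -/
def GraphGroupoid.Mem {C : Type u} {V : Type} {s t : V → Profile C} {c d : Profile C}
    (𝒢 : GraphGroupoid) (G : ColoredGraph s t c d) : Prop :=
  match 𝒢 with
  | wheelFree => True
  | connected => G.incidence.Connected
  | simplyConnected => G.incidence.IsTree

theorem GraphGroupoid.mem_of_isTree {C : Type u} {V : Type} {s t : V → Profile C}
    {c d : Profile C} (𝒢 : GraphGroupoid) {G : ColoredGraph s t c d} (h : G.incidence.IsTree) :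
    𝒢.Mem G := by
  cases 𝒢
  exacts [trivial, h.1, h]

theorem GraphGroupoid.mem_mapColor {C D : Type u} {V : Type} {s t : V → Profile C}
    {c d : Profile C} {𝒢 : GraphGroupoid} {G : ColoredGraph s t c d} (h : 𝒢.Mem G) (f : C → D) :
    𝒢.Mem (G.mapColor f) := by
  have H : (G.mapColor f).incidence = G.incidence := by
    ext (_ | _) (_ | _) <;> rfl
  cases 𝒢
  · trivial
  · change (G.mapColor f).incidence.Connected
    rw [H]
    exact h
  · change (G.mapColor f).incidence.IsTree
    rw [H]
    exact h

/-! ## Simplicial generalized props -/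

/-- The simplicial set `∏ v, P (t v; s v)` of decorations, by a family `P` of simplicial sets indexed
by biprofiles, of vertices `v` with input profiles `s v` and output profiles `t v`. -/
abbrev decorations {C : Type u} (P : Profile C → Profile C → SSet.{v}) {V : Type}
    (s t : V → Profile C) : SSet.{v} where
  obj n := ∀ v, (P (s v) (t v)).obj n
  map f := ↾fun x v => (P (s v) (t v)).map f (x v)
  map_id n := by
    ext x v
    exact ConcreteCategory.congr_hom ((P (s v) (t v)).map_id n) (x v)
  map_comp f g := by
    ext x v
    exact ConcreteCategory.congr_hom ((P (s v) (t v)).map_comp f g) (x v)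

/-- A (small) simplicial `Gr`-prop, where `Gr` is the graph groupoid `𝒢`: a set of colors, a
simplicial set `P (c; d)` for each biprofile, and for each colored graph in `Gr` a composition map
out of the simplicial set of decorations of its vertices. The composition along a corolla is the
identity, and composition is compatible with graph substitution.

The unit of the color `a` is the composition along the exceptional edge of color `a`. The actions of
the symmetric groups are the compositions along graphs with one vertex, the inputs and outputs of
which are ordered differently from those of the graph; equivariance, and the invariance under strict
isomorphisms, are cases of the compatibility with substitution. -/
structure SimplicialGrProp (𝒢 : GraphGroupoid) : Type (max (u + 1) (v + 1)) where
  /-- the set of colors -/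
  Col : Type u
  /-- the simplicial set with the given input profile and output profile -/
  obj : Profile Col → Profile Col → SSet.{v}
  /-- the composition map along a colored graph -/
  comp : ∀ {V : Type} [Finite V] {s t : V → Profile Col} {c d : Profile Col}
    (G : ColoredGraph s t c d), 𝒢.Mem G → (decorations obj s t ⟶ obj c d)
  comp_corolla : ∀ (c d : Profile Col) (n : SimplexCategoryᵒᵖ) (x : (obj c d).obj n),
    (comp (ColoredGraph.corolla c d) (𝒢.mem_of_isTree (ColoredGraph.corolla_isTree c d))).app n
      (fun _ => x) = x
  comp_substitution : ∀ {V U : Type} [Finite V] [Finite U] {W : V → Type} [∀ v, Finite (W v)]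
    {ι : ∀ v, W v → U} {s t : V → Profile Col} {a b : U → Profile Col} {c d : Profile Col}
    {G : ColoredGraph s t c d}
    {H : ∀ v, ColoredGraph (fun w => a (ι v w)) (fun w => b (ι v w)) (s v) (t v)}
    {K : ColoredGraph a b c d}, ColoredGraph.Substitution ι G H K →
    ∀ (hG : 𝒢.Mem G) (hH : ∀ v, 𝒢.Mem (H v)) (hK : 𝒢.Mem K)
      (n : SimplexCategoryᵒᵖ) (x : ∀ u, (obj (a u) (b u)).obj n),
      (comp K hK).app n x =
        (comp G hG).app n (fun v => (comp (H v) (hH v)).app n (fun w => x (ι v w)))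

namespace SimplicialGrProp

variable {𝒢 : GraphGroupoid}

/-- A morphism of simplicial `Gr`-props: a map of colors together with maps of simplicial sets which
are compatible with all composition maps (and hence with units and symmetric group actions). -/
@[ext]
structure Hom (P Q : SimplicialGrProp.{u, v} 𝒢) : Type (max u v) where
  /-- the map of colors -/
  col : P.Col → Q.Col
  /-- the maps of simplicial sets -/
  map : ∀ c d : Profile P.Col, P.obj c d ⟶ Q.obj (c.map col) (d.map col)
  map_comp : ∀ {V : Type} [Finite V] {s t : V → Profile P.Col} {c d : Profile P.Col}
    (G : ColoredGraph s t c d) (hG : 𝒢.Mem G) (n : SimplexCategoryᵒᵖ)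
    (x : ∀ v, (P.obj (s v) (t v)).obj n),
    (map c d).app n ((P.comp G hG).app n x) =
      (Q.comp (G.mapColor col) (𝒢.mem_mapColor hG col)).app n
        (fun v => (map (s v) (t v)).app n (x v))

instance : Category (SimplicialGrProp.{u, v} 𝒢) where
  Hom := Hom
  id P := ⟨id, fun _ _ => 𝟙 _, fun _ _ _ _ => rfl⟩
  comp {P Q R} f g := ⟨g.col ∘ f.col, fun c d => f.map c d ≫ g.map (c.map f.col) (d.map f.col),
    fun G hG n x => by
      refine (congrArg ((g.map _ _).app n) (f.map_comp G hG n x)).trans ?_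
      exact g.map_comp (G.mapColor f.col) (𝒢.mem_mapColor hG f.col) n _⟩
  id_comp _ := rfl
  comp_id _ := rfl
  assoc _ _ _ := rfl

/-! ### The underlying simplicial category -/

section

variable (P : SimplicialGrProp.{u, v} 𝒢)

/-- The unit of the color `x`, as a map out of the terminal simplicial set to `P (x; x)`. -/
def unit (x : P.Col) : 𝟙_ SSet.{v} ⟶ P.obj (Profile.single x) (Profile.single x) :=
  { app := fun n => ↾fun _ k => Empty.elim k
    naturality := fun n m f => by
      ext p k
      exact k.elim } ≫
  P.comp (ColoredGraph.exceptional Empty.elim Empty.elim x)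
    (𝒢.mem_of_isTree (ColoredGraph.exceptional_isTree _ _ _))

/-- The composable pairs of unary operations, as decorations of the linear graph with two vertices. -/
def pair (x y z : P.Col) :
    P.obj (Profile.single x) (Profile.single y) ⊗ P.obj (Profile.single y) (Profile.single z) ⟶
      decorations P.obj (fun k : Fin 2 => Profile.single (![x, y, z] k.castSucc))
        (fun k : Fin 2 => Profile.single (![x, y, z] k.succ)) where
  app n := ↾fun p k => match k with
    | 0 => p.1
    | 1 => p.2
  naturality n m f := by
    ext p k
    match k with
    | 0 => rfl
    | 1 => rfl

/-- The composition of unary operations along the linear graph with two vertices. -/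
def unaryComp (x y z : P.Col) :
    P.obj (Profile.single x) (Profile.single y) ⊗ P.obj (Profile.single y) (Profile.single z) ⟶
      P.obj (Profile.single x) (Profile.single z) :=
  P.pair x y z ≫ P.comp (ColoredGraph.linear 2 ![x, y, z])
    (𝒢.mem_of_isTree (ColoredGraph.linear_isTree _ _))

theorem comp_exceptional (x : P.Col) {V : Type} [IsEmpty V] [Finite V] (s t : V → Profile P.Col)
    (h : 𝒢.Mem (ColoredGraph.exceptional s t x)) (n : SimplexCategoryᵒᵖ)
    (y : ∀ v, (P.obj (s v) (t v)).obj n) :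
    (P.comp (ColoredGraph.exceptional s t x) h).app n y = (P.unit x).app n PUnit.unit := by
  let S : ColoredGraph.Substitution (V := Unit) (U := V) (W := fun _ => Empty) (fun _ w => w.elim)
      (ColoredGraph.corolla (Profile.single x) (Profile.single x))
      (fun _ => ColoredGraph.exceptional _ _ x) (ColoredGraph.exceptional s t x) :=
    { bijective := ⟨fun p => p.2.elim, fun v => isEmptyElim v⟩
      outer := fun _ => ()
      inner := fun _ _ => ()
      color_outer := by rintro (i | i) <;> rfl
      color_inner := fun _ _ => rfl
      glue_inp := fun _ _ => rfl
      glue_out := fun _ _ => rfl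
      inp_eq := fun _ => rfl
      out_eq := fun _ => rfl
      vinp_eq := fun _ w => w.elim
      vout_eq := fun _ w => w.elim }
  rw [P.comp_substitution S (𝒢.mem_of_isTree (ColoredGraph.corolla_isTree _ _))
    (fun _ => 𝒢.mem_of_isTree (ColoredGraph.exceptional_isTree _ _ _)), P.comp_corolla]
  have key : ∀ (s t : Empty → Profile P.Col) (h : 𝒢.Mem (ColoredGraph.exceptional s t x))
      (y : ∀ v, (P.obj (s v) (t v)).obj n),
      (P.comp (ColoredGraph.exceptional s t x) h).app n y = (P.unit x).app n PUnit.unit := by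
    intro s t h y
    obtain rfl : s = Empty.elim := Subsingleton.elim _ _
    obtain rfl : t = Empty.elim := Subsingleton.elim _ _
    obtain rfl : y = fun k => Empty.elim k := funext fun k => k.elim
    rfl
  exact key _ _ _ _

theorem comp_linear_two (a : Fin 3 → P.Col) (h : 𝒢.Mem (ColoredGraph.linear 2 a))
    (n : SimplexCategoryᵒᵖ) (x : ∀ k : Fin 2,
      (P.obj (Profile.single (a k.castSucc)) (Profile.single (a k.succ))).obj n) :
    (P.comp (ColoredGraph.linear 2 a) h).app n x =
      (P.unaryComp (a 0) (a 1) (a 2)).app n (x 0, x 1) := by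
  obtain ⟨p, q, r, rfl⟩ : ∃ p q r, a = ![p, q, r] :=
    ⟨a 0, a 1, a 2, by ext k; fin_cases k <;> rfl⟩
  refine congrArg ((P.comp (ColoredGraph.linear 2 ![p, q, r]) h).app n) ?_
  funext k
  match k with
  | 0 => rfl
  | 1 => rfl

theorem unit_unaryComp (x y : P.Col) (n : SimplexCategoryᵒᵖ)
    (f : (P.obj (Profile.single x) (Profile.single y)).obj n) :
    (P.unaryComp x x y).app n ((P.unit x).app n PUnit.unit, f) = f := by
  let W : Fin 2 → Type
    | 0 => Empty
    | 1 => Unit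
  have : ∀ v, Finite (W v)
    | 0 => inferInstanceAs (Finite Empty)
    | 1 => inferInstanceAs (Finite Unit)
  let H : ∀ v : Fin 2, ColoredGraph (fun _ : W v => Profile.single x)
      (fun _ : W v => Profile.single y) (Profile.single (![x, x, y] v.castSucc))
      (Profile.single (![x, x, y] v.succ))
    | 0 => ColoredGraph.exceptional (V := Empty) _ _ x
    | 1 => ColoredGraph.corolla (Profile.single x) (Profile.single y)
  have hH : ∀ v, 𝒢.Mem (H v)
    | 0 => 𝒢.mem_of_isTree (ColoredGraph.exceptional_isTree (V := Empty) _ _ x)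
    | 1 => 𝒢.mem_of_isTree (ColoredGraph.corolla_isTree _ _)
  let S : ColoredGraph.Substitution (fun (v : Fin 2) (_ : W v) => ())
      (ColoredGraph.linear 2 ![x, x, y]) H
      (ColoredGraph.corolla (Profile.single x) (Profile.single y)) :=
    { bijective := by
        refine ⟨?_, fun _ => ⟨⟨1, ()⟩, rfl⟩⟩
        rintro ⟨v, w⟩ ⟨v', w'⟩ -
        match v, v', w, w' with
        | 0, _, w, _ => exact Empty.elim w
        | 1, 0, _, w' => exact Empty.elim w'
        | 1, 1, _, _ => rfl
      outer := ![.inl (0 : Fin 1), .inl (0 : Fin 1), .inr (0 : Fin 1)]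
      inner := fun v => match v with
        | 0 => fun _ => .inl (0 : Fin 1)
        | 1 => fun e => e
      color_outer := fun e => by
        change Fin 3 at e
        fin_cases e <;> rfl
      color_inner := fun v e => match v with
        | 0 => rfl
        | 1 => rfl
      glue_inp := fun v i => match v with
        | 0 => rfl
        | 1 => congrArg Sum.inl (Subsingleton.elim (α := Fin 1) _ _)
      glue_out := fun v i => match v with
        | 0 => rfl
        | 1 => congrArg Sum.inr (Subsingleton.elim (α := Fin 1) _ _)
      inp_eq := fun i => congrArg Sum.inl (Subsingleton.elim (α := Fin 1) _ _)
      out_eq := fun i => congrArg Sum.inr (Subsingleton.elim (α := Fin 1) _ _)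
      vinp_eq := fun v w i => match v, w with
        | 0, w => Empty.elim w
        | 1, _ => rfl
      vout_eq := fun v w i => match v, w with
        | 0, w => Empty.elim w
        | 1, _ => rfl }
  have h := P.comp_substitution S (𝒢.mem_of_isTree (ColoredGraph.linear_isTree _ _)) hH
    (𝒢.mem_of_isTree (ColoredGraph.corolla_isTree _ _)) n (fun _ => f)
  refine Eq.trans ?_ (((P.comp_corolla _ _ n f).symm.trans (h.trans
    (P.comp_linear_two _ _ n _))).symm)
  refine congrArg ((P.unaryComp x x y).app n) (Prod.ext ?_ ?_)
  · exact (P.comp_exceptional x (V := Empty) _ _ _ _ _).symm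
  · exact (P.comp_corolla _ _ n f).symm

theorem unaryComp_unit (x y : P.Col) (n : SimplexCategoryᵒᵖ)
    (f : (P.obj (Profile.single x) (Profile.single y)).obj n) :
    (P.unaryComp x y y).app n (f, (P.unit y).app n PUnit.unit) = f := by
  let W : Fin 2 → Type
    | 0 => Unit
    | 1 => Empty
  have : ∀ v, Finite (W v)
    | 0 => inferInstanceAs (Finite Unit)
    | 1 => inferInstanceAs (Finite Empty)
  let H : ∀ v : Fin 2, ColoredGraph (fun _ : W v => Profile.single x)
      (fun _ : W v => Profile.single y) (Profile.single (![x, y, y] v.castSucc))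
      (Profile.single (![x, y, y] v.succ))
    | 0 => ColoredGraph.corolla (Profile.single x) (Profile.single y)
    | 1 => ColoredGraph.exceptional (V := Empty) _ _ y
  have hH : ∀ v, 𝒢.Mem (H v)
    | 0 => 𝒢.mem_of_isTree (ColoredGraph.corolla_isTree _ _)
    | 1 => 𝒢.mem_of_isTree (ColoredGraph.exceptional_isTree (V := Empty) _ _ y)
  let S : ColoredGraph.Substitution (fun (v : Fin 2) (_ : W v) => ())
      (ColoredGraph.linear 2 ![x, y, y]) H
      (ColoredGraph.corolla (Profile.single x) (Profile.single y)) :=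
    { bijective := by
        refine ⟨?_, fun _ => ⟨⟨0, ()⟩, rfl⟩⟩
        rintro ⟨v, w⟩ ⟨v', w'⟩ -
        match v, v', w, w' with
        | 1, _, w, _ => exact Empty.elim w
        | 0, 1, _, w' => exact Empty.elim w'
        | 0, 0, _, _ => rfl
      outer := ![.inl (0 : Fin 1), .inr (0 : Fin 1), .inr (0 : Fin 1)]
      inner := fun v => match v with
        | 0 => fun e => e
        | 1 => fun _ => .inr (0 : Fin 1)
      color_outer := fun e => by
        change Fin 3 at e
        fin_cases e <;> rfl
      color_inner := fun v e => match v with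
        | 0 => rfl
        | 1 => rfl
      glue_inp := fun v i => match v with
        | 0 => congrArg Sum.inl (Subsingleton.elim (α := Fin 1) _ _)
        | 1 => rfl
      glue_out := fun v i => match v with
        | 0 => congrArg Sum.inr (Subsingleton.elim (α := Fin 1) _ _)
        | 1 => rfl
      inp_eq := fun i => congrArg Sum.inl (Subsingleton.elim (α := Fin 1) _ _)
      out_eq := fun i => congrArg Sum.inr (Subsingleton.elim (α := Fin 1) _ _)
      vinp_eq := fun v w i => match v, w with
        | 0, _ => rfl
        | 1, w => Empty.elim w
      vout_eq := fun v w i => match v, w with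
        | 0, _ => rfl
        | 1, w => Empty.elim w }
  have h := P.comp_substitution S (𝒢.mem_of_isTree (ColoredGraph.linear_isTree _ _)) hH
    (𝒢.mem_of_isTree (ColoredGraph.corolla_isTree _ _)) n (fun _ => f)
  refine Eq.trans ?_ (((P.comp_corolla _ _ n f).symm.trans (h.trans
    (P.comp_linear_two _ _ n _))).symm)
  refine congrArg ((P.unaryComp x y y).app n) (Prod.ext ?_ ?_)
  · exact (P.comp_corolla _ _ n f).symm
  · exact (P.comp_exceptional y (V := Empty) _ _ _ _ _).symm

/-- Both ways to compose three unary operations agree with the composition along the linear graph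
with three vertices. -/
theorem unaryComp_left (a : Fin 4 → P.Col) (n : SimplexCategoryᵒᵖ)
    (x : ∀ k : Fin 3,
      (P.obj (Profile.single (a k.castSucc)) (Profile.single (a k.succ))).obj n) :
    (P.comp (ColoredGraph.linear 3 a) (𝒢.mem_of_isTree (ColoredGraph.linear_isTree _ _))).app n x =
      (P.unaryComp (a 0) (a 2) (a 3)).app n ((P.unaryComp (a 0) (a 1) (a 2)).app n (x 0, x 1), x 2) := by
  let W : Fin 2 → Type
    | 0 => Fin 2
    | 1 => Unit
  have : ∀ v, Finite (W v)
    | 0 => inferInstanceAs (Finite (Fin 2))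
    | 1 => inferInstanceAs (Finite Unit)
  let ι : ∀ v, W v → Fin 3
    | 0 => Fin.castSucc (n := 2)
    | 1 => fun _ => 2
  let b : Fin 3 → P.Col := ![a 0, a 2, a 3]
  let H : ∀ v : Fin 2, ColoredGraph (fun w : W v => Profile.single (a (ι v w).castSucc))
      (fun w : W v => Profile.single (a (ι v w).succ)) (Profile.single (b v.castSucc))
      (Profile.single (b v.succ))
    | 0 => ColoredGraph.linear 2 (fun k => a k.castSucc)
    | 1 => ColoredGraph.corolla (Profile.single (a 2)) (Profile.single (a 3))
  have hH : ∀ v, 𝒢.Mem (H v)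
    | 0 => 𝒢.mem_of_isTree (ColoredGraph.linear_isTree 2 _)
    | 1 => 𝒢.mem_of_isTree (ColoredGraph.corolla_isTree _ _)
  let S : ColoredGraph.Substitution ι (ColoredGraph.linear 2 b) H (ColoredGraph.linear 3 a) :=
    { bijective := by
        refine ⟨?_, ?_⟩
        · rintro ⟨v, w⟩ ⟨v', w'⟩ h
          match v, v', w, w', h with
          | 0, 0, w, w', h =>
            obtain rfl : w = w' := Fin.castSucc_injective 2 h
            rfl
          | 0, 1, w, _, h => exact absurd h (Fin.castSucc_ne_last (n := 2) w)
          | 1, 0, _, w', h => exact absurd h.symm (Fin.castSucc_ne_last (n := 2) w')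
          | 1, 1, _, _, _ => rfl
        · intro k
          match k with
          | 0 => exact ⟨⟨0, (0 : Fin 2)⟩, rfl⟩
          | 1 => exact ⟨⟨0, (1 : Fin 2)⟩, rfl⟩
          | 2 => exact ⟨⟨1, ()⟩, rfl⟩
      outer := ![(0 : Fin 4), (2 : Fin 4), (3 : Fin 4)]
      inner := fun v => match v with
        | 0 => Fin.castSucc (n := 3)
        | 1 => Sum.elim (fun _ => (2 : Fin 4)) fun _ => (3 : Fin 4)
      color_outer := fun e => by
        change Fin 3 at e
        fin_cases e <;> rfl
      color_inner := fun v e => match v, e with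
        | 0, _ => rfl
        | 1, .inl _ => rfl
        | 1, .inr _ => rfl
      glue_inp := fun v i => match v with
        | 0 => rfl
        | 1 => rfl
      glue_out := fun v i => match v with
        | 0 => rfl
        | 1 => rfl
      inp_eq := fun i => rfl
      out_eq := fun i => rfl
      vinp_eq := fun v w i => match v, w with
        | 0, _ => rfl
        | 1, _ => rfl
      vout_eq := fun v w i => match v, w with
        | 0, _ => rfl
        | 1, _ => rfl }
  have h := P.comp_substitution S (𝒢.mem_of_isTree (ColoredGraph.linear_isTree _ _)) hH
    (𝒢.mem_of_isTree (ColoredGraph.linear_isTree _ _)) n x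
  refine h.trans ((P.comp_linear_two _ _ n _).trans ?_)
  refine congrArg ((P.unaryComp (a 0) (a 2) (a 3)).app n) (Prod.ext ?_ ?_)
  · exact P.comp_linear_two (fun k => a k.castSucc) _ n fun k => x k.castSucc
  · exact P.comp_corolla _ _ n (x 2)

theorem unaryComp_right (a : Fin 4 → P.Col) (n : SimplexCategoryᵒᵖ)
    (x : ∀ k : Fin 3,
      (P.obj (Profile.single (a k.castSucc)) (Profile.single (a k.succ))).obj n) :
    (P.comp (ColoredGraph.linear 3 a) (𝒢.mem_of_isTree (ColoredGraph.linear_isTree _ _))).app n x =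
      (P.unaryComp (a 0) (a 1) (a 3)).app n (x 0, (P.unaryComp (a 1) (a 2) (a 3)).app n (x 1, x 2)) := by
  let W : Fin 2 → Type
    | 0 => Unit
    | 1 => Fin 2
  have : ∀ v, Finite (W v)
    | 0 => inferInstanceAs (Finite Unit)
    | 1 => inferInstanceAs (Finite (Fin 2))
  let ι : ∀ v, W v → Fin 3
    | 0 => fun _ => 0
    | 1 => Fin.succ (n := 2)
  let b : Fin 3 → P.Col := ![a 0, a 1, a 3]
  let H : ∀ v : Fin 2, ColoredGraph (fun w : W v => Profile.single (a (ι v w).castSucc))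
      (fun w : W v => Profile.single (a (ι v w).succ)) (Profile.single (b v.castSucc))
      (Profile.single (b v.succ))
    | 0 => ColoredGraph.corolla (Profile.single (a 0)) (Profile.single (a 1))
    | 1 => ColoredGraph.linear 2 (fun k => a k.succ)
  have hH : ∀ v, 𝒢.Mem (H v)
    | 0 => 𝒢.mem_of_isTree (ColoredGraph.corolla_isTree _ _)
    | 1 => 𝒢.mem_of_isTree (ColoredGraph.linear_isTree 2 _)
  let S : ColoredGraph.Substitution ι (ColoredGraph.linear 2 b) H (ColoredGraph.linear 3 a) :=
    { bijective := by
        refine ⟨?_, ?_⟩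
        · rintro ⟨v, w⟩ ⟨v', w'⟩ h
          match v, v', w, w', h with
          | 1, 1, w, w', h =>
            obtain rfl : w = w' := Fin.succ_injective 2 h
            rfl
          | 1, 0, w, _, h => exact absurd h (Fin.succ_ne_zero (n := 2) w)
          | 0, 1, _, w', h => exact absurd h.symm (Fin.succ_ne_zero (n := 2) w')
          | 0, 0, _, _, _ => rfl
        · intro k
          match k with
          | 0 => exact ⟨⟨0, ()⟩, rfl⟩
          | 1 => exact ⟨⟨1, (0 : Fin 2)⟩, rfl⟩
          | 2 => exact ⟨⟨1, (1 : Fin 2)⟩, rfl⟩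
      outer := ![(0 : Fin 4), (1 : Fin 4), (3 : Fin 4)]
      inner := fun v => match v with
        | 0 => Sum.elim (fun _ => (0 : Fin 4)) fun _ => (1 : Fin 4)
        | 1 => Fin.succ (n := 3)
      color_outer := fun e => by
        change Fin 3 at e
        fin_cases e <;> rfl
      color_inner := fun v e => match v, e with
        | 0, .inl _ => rfl
        | 0, .inr _ => rfl
        | 1, _ => rfl
      glue_inp := fun v i => match v with
        | 0 => rfl
        | 1 => rfl
      glue_out := fun v i => match v with
        | 0 => rfl
        | 1 => rfl
      inp_eq := fun i => rfl
      out_eq := fun i => rfl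
      vinp_eq := fun v w i => match v, w with
        | 0, _ => rfl
        | 1, _ => rfl
      vout_eq := fun v w i => match v, w with
        | 0, _ => rfl
        | 1, _ => rfl }
  have h := P.comp_substitution S (𝒢.mem_of_isTree (ColoredGraph.linear_isTree _ _)) hH
    (𝒢.mem_of_isTree (ColoredGraph.linear_isTree _ _)) n x
  refine h.trans ((P.comp_linear_two _ _ n _).trans ?_)
  refine congrArg ((P.unaryComp (a 0) (a 1) (a 3)).app n) (Prod.ext ?_ ?_)
  · exact P.comp_corolla _ _ n (x 0)
  · exact P.comp_linear_two (fun k => a k.succ) _ n fun k => x k.succ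

end

/-- The underlying simplicial category of a simplicial `Gr`-prop `P`: its objects are the colors of
`P`, and its simplicial set of morphisms from `x` to `y` is `P (x; y)`. -/
def underlying (P : SimplicialGrProp.{u, v} 𝒢) : SCat.{u, v} where
  Obj := P.Col
  enriched :=
    { Hom := fun x y => P.obj (Profile.single x) (Profile.single y)
      id := fun x => P.unit x
      comp := fun x y z => P.unaryComp x y z
      id_comp := fun x y => by
        ext n f
        exact P.unit_unaryComp x y n f
      comp_id := fun x y => by
        ext n f
        exact P.unaryComp_unit x y n f
      assoc := fun w x y z => by
        ext n ⟨f, g, h⟩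
        let p : ∀ k : Fin 3, (P.obj (Profile.single (![w, x, y, z] k.castSucc))
            (Profile.single (![w, x, y, z] k.succ))).obj n := fun k => match k with
          | 0 => f
          | 1 => g
          | 2 => h
        exact (P.unaryComp_left ![w, x, y, z] n p).symm.trans (P.unaryComp_right ![w, x, y, z] n p) }

/-- The forgetful functor from simplicial `Gr`-props to simplicial categories. -/
def forget : SimplicialGrProp.{u, v} 𝒢 ⥤ SCat.{u, v} where
  obj P := P.underlying
  map {P Q} f :=
    { obj := f.col
      map := fun x y => f.map (Profile.single x) (Profile.single y)
      map_id := fun x => by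
        ext n p
        refine (f.map_comp (ColoredGraph.exceptional Empty.elim Empty.elim x)
          (𝒢.mem_of_isTree (ColoredGraph.exceptional_isTree _ _ _)) n _).trans ?_
        exact Q.comp_exceptional (f.col x) _ _ (𝒢.mem_of_isTree
          (ColoredGraph.exceptional_isTree _ _ _)) n _
      map_comp := fun x y z => by
        ext n ⟨p, q⟩
        refine (f.map_comp (ColoredGraph.linear 2 ![x, y, z])
          (𝒢.mem_of_isTree (ColoredGraph.linear_isTree _ _)) n _).trans ?_
        exact Q.comp_linear_two (f.col ∘ ![x, y, z])
          (𝒢.mem_of_isTree (ColoredGraph.linear_isTree _ _)) n _ }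
  map_id _ := rfl
  map_comp _ _ := rfl

/-- The local equivalences: the morphisms which are weak homotopy equivalences at each biprofile. -/
def localEquivalences (𝒢 : GraphGroupoid) : MorphismProperty (SimplicialGrProp.{u, v} 𝒢) :=
  fun P _ f => ∀ c d : Profile P.Col, SSet.weakHomotopyEquivalences (Hom.map f c d)

/-- The weak equivalences of simplicial `Gr`-props: the local equivalences whose underlying functor
of simplicial categories is a weak equivalence. -/
def weakEquivalences (𝒢 : GraphGroupoid) : MorphismProperty (SimplicialGrProp.{u, v} 𝒢) :=
  SCat.weakEquivalences.inverseImage forget ⊓ localEquivalences 𝒢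

end SimplicialGrProp

/-!
A morphism of simplicial `Gr`-props is a weak equivalence iff it is a local equivalence and induces
an equivalence on categories of components, because the simplicial sets of morphisms of the
underlying simplicial category are the values at the biprofiles `(x; y)` with single entries
(`SimplicialGrProp.weakEquivalences_iff`). Equivalences of categories have the two-out-of-three
property and are stable under retracts, and so are the maps which become bijections under
`π₀ (Fun(-, Z))` for all Kan complexes `Z`. This settles all assertions about weak equivalences except
one: if `g : P ⟶ Q` and `g ≫ f` are weak equivalences, then `f : Q ⟶ R` is a local equivalence. By
two-out-of-three, `f` is a weak homotopy equivalence at the biprofiles of `Q` with colors in the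
image of `g`, and it remains to reach the others.

Every color of `Q` is isomorphic to one in the image of `g` in the category of components. Choose
unary operations representing such isomorphisms for all entries of a biprofile `(c; d)`. Composing
with them at all inputs and outputs is the composition along a tree, the spider
`ColoredGraph.spider`, and it compares `Q (c; d)` with the value of `Q` at a biprofile with colors
in the image of `g`. This comparison is natural for `f` (`SimplicialGrProp.map_graft`), so it
suffices that it is a weak homotopy equivalence
(`SimplicialGrProp.weakHomotopyEquivalences_slice_graft`). Here the inverse isomorphisms yield a
comparison in the other direction. Compatibility with substitution shows that the composite of the
two is the comparison by the products of the unary operations (`SimplicialGrProp.graft_graft`),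
which lie in the components of the units, and that the comparison by units is the identity
(`SimplicialGrProp.graft_unitLegs`). Finally, the map induced on `π₀ (Fun(-, Z))` depends on the
components of the unary operations only, since composition is a map of simplicial sets in all
variables (`SSet.mapπ₀_pre_slice_congr`).

Local equivalences fail to have the two-out-of-three property because of morphisms which are not
essentially surjective: a `Gr`-prop without colors only sees the biprofile `(∅; ∅)`
(`SimplicialGrProp.not_hasTwoOutOfThreeProperty_localEquivalences`).
-/

/-! ### Weak homotopy equivalences of simplicial sets -/

namespace SSet

open scoped Simplicial

theorem weakHomotopyEquivalences_of_isIso {X Y : SSet.{v}} (f : X ⟶ Y) [IsIso f] :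
    weakHomotopyEquivalences f := by
  intro Z _
  have : IsIso (MonoidalClosed.pre f) :=
    inferInstanceAs (IsIso (MonoidalClosed.internalHom.map f.op))
  have : IsIso (π₀Functor.map ((MonoidalClosed.pre f).app Z)) := inferInstance
  exact (isIso_iff_bijective _).1 this

theorem mapπ₀_pre_comp {X Y W : SSet.{v}} (f : X ⟶ Y) (g : Y ⟶ W) (Z : SSet.{v}) :
    mapπ₀ ((MonoidalClosed.pre (f ≫ g)).app Z) =
      mapπ₀ ((MonoidalClosed.pre f).app Z) ∘ mapπ₀ ((MonoidalClosed.pre g).app Z) := by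
  ext x
  rw [MonoidalClosed.pre_map, NatTrans.comp_app, mapπ₀_comp_apply]
  rfl

theorem mapπ₀_pre_id (X Z : SSet.{v}) : mapπ₀ ((MonoidalClosed.pre (𝟙 X)).app Z) = id := by
  ext x
  rw [MonoidalClosed.pre_id]
  exact mapπ₀_id_apply x

theorem weakHomotopyEquivalences_comp {X Y W : SSet.{v}} {f : X ⟶ Y} {g : Y ⟶ W}
    (hf : weakHomotopyEquivalences f) (hg : weakHomotopyEquivalences g) :
    weakHomotopyEquivalences (f ≫ g) := by
  intro Z hZ
  rw [mapπ₀_pre_comp]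
  exact (hf Z hZ).comp (hg Z hZ)

theorem weakHomotopyEquivalences_of_postcomp {X Y W : SSet.{v}} {f : X ⟶ Y} {g : Y ⟶ W}
    (hg : weakHomotopyEquivalences g) (hfg : weakHomotopyEquivalences (f ≫ g)) :
    weakHomotopyEquivalences f := by
  intro Z hZ
  have h := hfg Z hZ
  rw [mapπ₀_pre_comp] at h
  exact (Function.Bijective.of_comp_iff _ (hg Z hZ)).1 h

theorem weakHomotopyEquivalences_of_precomp {X Y W : SSet.{v}} {f : X ⟶ Y} {g : Y ⟶ W}
    (hf : weakHomotopyEquivalences f) (hfg : weakHomotopyEquivalences (f ≫ g)) :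
    weakHomotopyEquivalences g := by
  intro Z hZ
  have h := hfg Z hZ
  rw [mapπ₀_pre_comp] at h
  exact (Function.Bijective.of_comp_iff' (hf Z hZ) _).1 h

open CartesianMonoidalCategory in
/-- The map `X ⟶ Y` obtained from `H : X ⊗ A ⟶ Y` by fixing a vertex of the parameter space `A`. -/
noncomputable def slice {X A Y : SSet.{v}} (H : X ⊗ A ⟶ Y) (a : A _⦋0⦌) : X ⟶ Y :=
  lift (𝟙 X) (const a) ≫ H

/-- Maps parametrized by vertices in the same connected component of the parameter space become
equal after applying `π₀ (Fun(-, Z))`. -/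
theorem mapπ₀_pre_slice_congr {X A Y : SSet.{v}} (H : X ⊗ A ⟶ Y) {a b : A _⦋0⦌}
    (h : π₀.mk a = π₀.mk b) (Z : SSet.{v}) :
    mapπ₀ ((MonoidalClosed.pre (slice H a)).app Z) =
      mapπ₀ ((MonoidalClosed.pre (slice H b)).app Z) := by
  let K := (ihom Y).obj Z
  let m : A ⊗ K ⟶ (ihom X).obj Z :=
    MonoidalClosed.curry ((α_ X A K).inv ≫ H ▷ K ≫ (ihom.ev Y).app Z)
  have key (a : A _⦋0⦌) : (MonoidalClosed.pre (slice H a)).app Z =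
      CartesianMonoidalCategory.lift (const a) (𝟙 K) ≫ m := by
    apply MonoidalClosed.uncurry_injective
    rw [MonoidalClosed.uncurry_pre, MonoidalClosed.uncurry_natural_left,
      MonoidalClosed.uncurry_curry]
    rfl
  have key' (a : A _⦋0⦌) (k : π₀ K) : mapπ₀ ((MonoidalClosed.pre (slice H a)).app Z) k =
      mapπ₀ m (SCat.piZeroPair (π₀.mk a) k) := by
    obtain ⟨k, rfl⟩ := π₀.mk_surjective k
    rw [key, mapπ₀_comp_apply]
    refine congrArg (mapπ₀ m) (congrArg π₀.mk (Prod.ext ?_ rfl))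
    refine Eq.trans ?_ (ConcreteCategory.congr_hom (A.map_id (op ⦋0⦌)) a)
    change A.map (SimplexCategory.const ⦋0⦌ ⦋0⦌ 0).op a = _
    rw [SimplexCategory.const_eq_id]
    rfl
  ext k
  rw [key', key', h]

/-- The empty simplicial set is a Kan complex, so it detects weak homotopy equivalences: there is a
map into it from the empty simplicial set only. -/
theorem nonempty_of_weakHomotopyEquivalences {X Y : SSet.{v}} {f : X ⟶ Y}
    (hf : weakHomotopyEquivalences f) (y : Y _⦋0⦌) : Nonempty (X _⦋0⦌) := by
  by_contra hX
  rw [not_nonempty_iff] at hX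
  have hK : KanComplex X := KanComplex.iff.2 fun n i φ _ => by
    obtain ⟨j, hj⟩ := exists_ne i
    exact hX.elim ((φ j hj).app _ (stdSimplex.const n 0 (op ⦋0⦌)))
  obtain ⟨k, -⟩ := (hf X hK).2
    (π₀.mk ((MonoidalClosed.curry (ρ_ X).hom).app (op ⦋0⦌) PUnit.unit))
  obtain ⟨k, rfl⟩ := π₀.mk_surjective k
  exact hX.elim (((ihom.ev Y).app X).app (op ⦋0⦌) (y, k))

end SSet

/-! ### Weak equivalences of simplicial `Gr`-props: composition and retracts -/

namespace SCat

theorem piZeroMap_comp {C D E : SCat.{u, v}} (F : C ⟶ D) (G : D ⟶ E) :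
    piZeroMap (F ≫ G) = piZeroMap F ⋙ piZeroMap G := by
  refine Functor.hext (fun _ => rfl) fun a b f => heq_of_eq ?_
  obtain ⟨x, rfl⟩ := SSet.π₀.mk_surjective f
  rfl

theorem piZeroMap_id (C : SCat.{u, v}) : piZeroMap (𝟙 C) = 𝟭 (PiZero C) := by
  refine Functor.hext (fun _ => rfl) fun a b f => heq_of_eq ?_
  obtain ⟨x, rfl⟩ := SSet.π₀.mk_surjective f
  rfl

end SCat

/-- A retract of an equivalence of categories is an equivalence: the retract of an inverse is an
inverse. -/
theorem CategoryTheory.Functor.isEquivalence_of_retract {C D C' D' : Type*} [Category* C]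
    [Category* D] [Category* C'] [Category* D'] (F : C ⥤ D) (G : C' ⥤ D') [G.IsEquivalence]
    {I : C ⥤ C'} {R : C' ⥤ C} {I' : D ⥤ D'} {R' : D' ⥤ D}
    (hI : I ⋙ G = F ⋙ I') (hR : R ⋙ F = G ⋙ R') (h : I ⋙ R = 𝟭 C) (h' : I' ⋙ R' = 𝟭 D) :
    F.IsEquivalence := by
  let e : C ≌ D := CategoryTheory.Equivalence.mk F (I' ⋙ G.inv ⋙ R)
    (eqToIso h.symm ≪≫
      Functor.isoWhiskerLeft I (Functor.isoWhiskerRight G.asEquivalence.unitIso R) ≪≫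
      eqToIso (by
        change (I ⋙ G) ⋙ G.inv ⋙ R = _
        rw [hI]; rfl))
    (eqToIso (by
        change I' ⋙ G.inv ⋙ (R ⋙ F) = (I' ⋙ G.inv ⋙ G ⋙ R')
        rw [hR]) ≪≫
      Functor.isoWhiskerLeft I' (Functor.isoWhiskerRight G.asEquivalence.counitIso R') ≪≫
      eqToIso h')
  exact e.isEquivalence_functor

namespace SimplicialGrProp

variable {𝒢 : GraphGroupoid}

theorem weakEquivalences_iff {P Q : SimplicialGrProp.{u, v} 𝒢} (f : P ⟶ Q) :
    weakEquivalences 𝒢 f ↔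
      localEquivalences 𝒢 f ∧ (SCat.piZeroMap (forget.map f)).IsEquivalence :=
  ⟨fun h => ⟨h.2, h.1.2⟩, fun h => ⟨⟨fun _ _ => h.1 _ _, h.2⟩, h.1⟩⟩

/-- The map `π₀ (Fun(Q (f c; f d), Z)) → π₀ (Fun(P (c; d), Z))` induced by a morphism `f : P ⟶ Q`.
-/
noncomputable def piZeroPre {P Q : SimplicialGrProp.{u, v} 𝒢} (f : P ⟶ Q) (c d : Profile P.Col)
    (Z : SSet.{v}) :
    SSet.π₀ ((ihom (Q.obj (c.map (Hom.col f)) (d.map (Hom.col f)))).obj Z) →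
      SSet.π₀ ((ihom (P.obj c d)).obj Z) :=
  SSet.mapπ₀ ((MonoidalClosed.pre (Hom.map f c d)).app Z)

theorem piZeroPre_comp {P Q R : SimplicialGrProp.{u, v} 𝒢} (f : P ⟶ Q) (g : Q ⟶ R)
    (c d : Profile P.Col) (Z : SSet.{v}) :
    piZeroPre (f ≫ g) c d Z =
      piZeroPre f c d Z ∘ piZeroPre g (c.map (Hom.col f)) (d.map (Hom.col f)) Z :=
  SSet.mapπ₀_pre_comp _ _ _

theorem bijective_piZeroPre_id (P : SimplicialGrProp.{u, v} 𝒢) (c d : Profile P.Col)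
    (Z : SSet.{v}) : Function.Bijective (piZeroPre (𝟙 P) c d Z) := by
  have : piZeroPre (𝟙 P) c d Z = id := SSet.mapπ₀_pre_id (P.obj c d) Z
  rw [this]
  exact Function.bijective_id

theorem localEquivalences_of_retract {P Q P' Q' : SimplicialGrProp.{u, v} 𝒢} {f : P ⟶ Q}
    {g : P' ⟶ Q'} (h : RetractArrow f g) (hg : localEquivalences 𝒢 g) :
    localEquivalences 𝒢 f := by
  intro c d Z hZ
  have hl : Function.Bijective (piZeroPre (h.i.left ≫ h.r.left) c d Z) := by
    rw [h.retract_left]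
    exact bijective_piZeroPre_id _ _ _ _
  have hr : Function.Bijective (piZeroPre (h.i.right ≫ h.r.right)
      (c.map (Hom.col f)) (d.map (Hom.col f)) Z) := by
    rw [h.retract_right]
    exact bijective_piZeroPre_id _ _ _ _
  rw [piZeroPre_comp] at hl hr
  have hg' : Function.Bijective (piZeroPre g (c.map (Hom.col h.i.left))
    (d.map (Hom.col h.i.left)) Z) := hg _ _ Z hZ
  constructor
  -- The profile `r (i c)` is `c` only up to propositional equality, so injectivity at
  -- `(r (i c); r (i d))` is transported along equalities of maps of colors.
  · have hcol : Hom.col (h.i.left ≫ h.r.left) = id := congrArg Hom.col h.retract_left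
    have hcol' : Hom.col (h.i.left ≫ g) = Hom.col (f ≫ h.i.right) := congrArg Hom.col h.i_w
    have h1 : Function.Injective (piZeroPre h.r.right (c.map (Hom.col (h.i.left ≫ g)))
        (d.map (Hom.col (h.i.left ≫ g))) Z) := by
      rw [hcol']
      exact hr.1.of_comp
    have h2 : Function.Injective (piZeroPre (h.r.left ≫ f) (c.map (Hom.col h.i.left))
        (d.map (Hom.col h.i.left)) Z) := by
      rw [h.r_w, piZeroPre_comp]
      exact hg'.1.comp h1
    rw [piZeroPre_comp] at h2
    have h3 : Function.Injective (piZeroPre f (c.map (Hom.col (h.i.left ≫ h.r.left)))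
        (d.map (Hom.col (h.i.left ≫ h.r.left))) Z) := h2.of_comp
    rw [hcol] at h3
    exact h3
  · have h1 : Function.Surjective (piZeroPre (f ≫ h.i.right) c d Z) := by
      rw [← h.i_w, piZeroPre_comp]
      exact hl.2.of_comp.comp hg'.2
    rw [piZeroPre_comp] at h1
    exact h1.of_comp

theorem weakEquivalences_of_retract {P Q P' Q' : SimplicialGrProp.{u, v} 𝒢} {f : P ⟶ Q}
    {g : P' ⟶ Q'} (h : RetractArrow f g) (hg : weakEquivalences 𝒢 g) :
    weakEquivalences 𝒢 f := by
  rw [weakEquivalences_iff] at hg ⊢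
  refine ⟨localEquivalences_of_retract h hg.1, ?_⟩
  have := hg.2
  have H {A B C D : SimplicialGrProp.{u, v} 𝒢} {a : A ⟶ B} {b : B ⟶ D} {a' : A ⟶ C} {b' : C ⟶ D}
      (w : a ≫ b = a' ≫ b') :
      SCat.piZeroMap (forget.map a) ⋙ SCat.piZeroMap (forget.map b) =
        SCat.piZeroMap (forget.map a') ⋙ SCat.piZeroMap (forget.map b') := by
    rw [← SCat.piZeroMap_comp, ← SCat.piZeroMap_comp, ← Functor.map_comp, ← Functor.map_comp, w]
  have H' {A B : SimplicialGrProp.{u, v} 𝒢} {a : A ⟶ B} {b : B ⟶ A} (w : a ≫ b = 𝟙 A) :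
      SCat.piZeroMap (forget.map a) ⋙ SCat.piZeroMap (forget.map b) = 𝟭 _ := by
    rw [← SCat.piZeroMap_comp, ← Functor.map_comp, w, CategoryTheory.Functor.map_id,
      SCat.piZeroMap_id]
  exact Functor.isEquivalence_of_retract _ (SCat.piZeroMap (forget.map g)) (H h.i_w) (H h.r_w)
    (H' h.retract_left) (H' h.retract_right)

theorem localEquivalences_comp {P Q R : SimplicialGrProp.{u, v} 𝒢} {f : P ⟶ Q} {g : Q ⟶ R}
    (hf : localEquivalences 𝒢 f) (hg : localEquivalences 𝒢 g) : localEquivalences 𝒢 (f ≫ g) :=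
  fun c d => SSet.weakHomotopyEquivalences_comp (hf c d) (hg _ _)

theorem localEquivalences_of_postcomp {P Q R : SimplicialGrProp.{u, v} 𝒢} {f : P ⟶ Q} {g : Q ⟶ R}
    (hg : localEquivalences 𝒢 g) (hfg : localEquivalences 𝒢 (f ≫ g)) : localEquivalences 𝒢 f :=
  fun c d => SSet.weakHomotopyEquivalences_of_postcomp (hg _ _) (hfg c d)

theorem weakEquivalences_comp {P Q R : SimplicialGrProp.{u, v} 𝒢} {f : P ⟶ Q} {g : Q ⟶ R}
    (hf : weakEquivalences 𝒢 f) (hg : weakEquivalences 𝒢 g) : weakEquivalences 𝒢 (f ≫ g) := by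
  rw [weakEquivalences_iff] at hf hg ⊢
  have := hf.2
  have := hg.2
  refine ⟨localEquivalences_comp hf.1 hg.1, ?_⟩
  rw [Functor.map_comp, SCat.piZeroMap_comp]
  infer_instance

theorem weakEquivalences_of_postcomp {P Q R : SimplicialGrProp.{u, v} 𝒢} {f : P ⟶ Q} {g : Q ⟶ R}
    (hg : weakEquivalences 𝒢 g) (hfg : weakEquivalences 𝒢 (f ≫ g)) : weakEquivalences 𝒢 f := by
  rw [weakEquivalences_iff] at hg hfg ⊢
  refine ⟨localEquivalences_of_postcomp hg.1 hfg.1, ?_⟩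
  have := hg.2
  have h := hfg.2
  rw [Functor.map_comp, SCat.piZeroMap_comp] at h
  exact Functor.isEquivalence_of_comp_right _ (SCat.piZeroMap (forget.map g))

end SimplicialGrProp

/-! ### Local equivalences do not have the two-out-of-three property -/

/-- In a graph all of whose vertices have as many inputs as outputs, there are as many graph inputs
as graph outputs: both counts complement the vertex counts to the number of edges. -/
theorem ColoredGraph.len_eq_len {C : Type u} {V : Type} [Finite V] {s t : V → Profile C}
    {c d : Profile C} (G : ColoredGraph s t c d) (h : ∀ v, (s v).len = (t v).len) :
    c.len = d.len := by
  have := Fintype.ofFinite V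
  have e := Fintype.card_congr
    ((Equiv.ofBijective _ G.source_bijective).trans (Equiv.ofBijective _ G.target_bijective).symm)
  simp only [Fintype.card_sum, Fintype.card_sigma, Fintype.card_fin, h] at e
  omega

namespace SimplicialGrProp

variable {𝒢 : GraphGroupoid}

/-- The simplicial `Gr`-prop with the given set of colors in which `P (c; d)` is a point if the
relation `p` holds for the lengths of `c` and `d`, and empty otherwise. -/
def ofRel (𝒢 : GraphGroupoid) (C : Type u) (p : ℕ → ℕ → Prop)
    (hp : ∀ {V : Type} [Finite V] {s t : V → Profile C} {c d : Profile C}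
      (_ : ColoredGraph s t c d), (∀ v, p (s v).len (t v).len) → p c.len d.len) :
    SimplicialGrProp.{u, v} 𝒢 where
  Col := C
  obj c d := (Functor.const _).obj (ULift (PLift (p c.len d.len)))
  comp {V _ s t c d} G _ :=
    { app := fun _ => ↾fun x => ⟨⟨hp G fun v => (x v).down.down⟩⟩
      naturality := fun _ _ _ => by
        ext
        exact Subsingleton.elim (α := ULift (PLift _)) _ _ }
  comp_corolla _ _ _ _ := Subsingleton.elim (α := ULift (PLift _)) _ _
  comp_substitution _ _ _ _ _ _ := Subsingleton.elim (α := ULift (PLift _)) _ _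

/-- The morphism induced by a map of colors and an implication of relations. -/
def ofRelMap {C D : Type u} {p q : ℕ → ℕ → Prop} {hp} {hq} (f : C → D)
    (h : ∀ m n, p m n → q m n) :
    ofRel.{u, v} 𝒢 C p hp ⟶ ofRel.{u, v} 𝒢 D q hq where
  col := f
  map _ _ := (Functor.const _).map (↾fun x => ⟨⟨h _ _ x.down.down⟩⟩)
  map_comp _ _ _ _ := Subsingleton.elim (α := ULift (PLift _)) _ _

theorem localEquivalences_ofRelMap {C D : Type u} {p q : ℕ → ℕ → Prop} {hp} {hq} (f : C → D)
    (h : ∀ m n, p m n → q m n) (h' : ∀ c d : Profile C, q c.len d.len → p c.len d.len) :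
    localEquivalences 𝒢 (ofRelMap.{u, v} (𝒢 := 𝒢) (hp := hp) (hq := hq) f h) := by
  intro c d
  have : IsIso (C := Type v) (X := ULift (PLift (p c.len d.len)))
      (Y := ULift (PLift (q c.len d.len))) (↾fun x => ⟨⟨h _ _ x.down.down⟩⟩) :=
    (isIso_iff_bijective _).2 ⟨fun _ _ _ => Subsingleton.elim (α := ULift (PLift _)) _ _,
      fun y => ⟨⟨⟨h' _ _ y.down.down⟩⟩, rfl⟩⟩
  exact SSet.weakHomotopyEquivalences_of_isIso ((Functor.const _).map (C := Type v)
    (X := ULift (PLift (p c.len d.len))) (Y := ULift (PLift (q c.len d.len)))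
    (↾fun x => ⟨⟨h _ _ x.down.down⟩⟩))

/-- Without colors there is only the biprofile `(∅; ∅)`, so two one-colored `Gr`-props which agree
there, but not elsewhere, receive local equivalences from the same `Gr`-prop without colors. -/
theorem not_hasTwoOutOfThreeProperty_localEquivalences (𝒢 : GraphGroupoid) :
    ¬ (localEquivalences.{u, v} 𝒢).HasTwoOutOfThreeProperty := by
  intro _
  have hC (c : Profile PEmpty.{u + 1}) : c.len = 0 := by
    by_contra hc
    exact (c.col ⟨0, Nat.pos_of_ne_zero hc⟩).elim
  let P : SimplicialGrProp.{u, v} 𝒢 := ofRel 𝒢 PEmpty (· = ·) fun G h => G.len_eq_len h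
  let Q : SimplicialGrProp.{u, v} 𝒢 := ofRel 𝒢 PUnit (· = ·) fun G h => G.len_eq_len h
  let R : SimplicialGrProp.{u, v} 𝒢 := ofRel 𝒢 PUnit (fun _ _ => True) fun _ _ => trivial
  let g : P ⟶ Q := ofRelMap PEmpty.elim fun _ _ h => h
  let f : Q ⟶ R := ofRelMap id fun _ _ _ => trivial
  have hg : localEquivalences 𝒢 g := localEquivalences_ofRelMap _ _ fun _ _ h => h
  have hgf : localEquivalences 𝒢 (g ≫ f) :=
    localEquivalences_ofRelMap (fun x => PEmpty.elim x) (fun _ _ _ => trivial)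
      fun c d _ => (hC c).trans (hC d).symm
  have hf : localEquivalences 𝒢 f := MorphismProperty.of_precomp _ g f hg hgf
  -- At the biprofile with one input and no outputs, `Q` is empty and `R` is a point.
  obtain ⟨x⟩ := SSet.nonempty_of_weakHomotopyEquivalences
    (hf (Profile.single PUnit.unit) ⟨0, Fin.elim0⟩) (ULift.up (PLift.up trivial))
  exact one_ne_zero (α := ℕ) x.down.down

end SimplicialGrProp

/-! ### Spiders -/

namespace ColoredGraph

namespace Spider

variable {m n k : ℕ}

/-- The edge at which the `j`-th vertex of a leg starts: the legs ending at an input of the body are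
directed towards the body, the other ones away from it. -/
def before : Fin m ⊕ Fin n → Fin k → Fin (k + 1)
  | .inl _, j => j.succ
  | .inr _, j => j.castSucc

/-- The edge following the `j`-th vertex of a leg. -/
def after : Fin m ⊕ Fin n → Fin k → Fin (k + 1)
  | .inl _, j => j.castSucc
  | .inr _, j => j.succ

/-- The number of inputs of a vertex. Here `none` is the body of the spider and `some (l, j)` is the
`j`-th vertex of the leg `l`, where `Sum.inl i` is the leg at the `i`-th input of the body and
`Sum.inr i` the leg at its `i`-th output. -/
def lenIn : Option ((Fin m ⊕ Fin n) × Fin k) → ℕ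
  | none => m
  | some _ => 1

/-- The number of outputs of a vertex. -/
def lenOut : Option ((Fin m ⊕ Fin n) × Fin k) → ℕ
  | none => n
  | some _ => 1

/-- The inputs of a vertex. -/
def inputs : ∀ v : Option ((Fin m ⊕ Fin n) × Fin k), Fin (lenIn v) → (Fin m ⊕ Fin n) × Fin (k + 1)
  | none, i => (.inl i, 0)
  | some (l, j), _ => (l, before l j)

/-- The outputs of a vertex. -/
def outputs : ∀ v : Option ((Fin m ⊕ Fin n) × Fin k), Fin (lenOut v) → (Fin m ⊕ Fin n) × Fin (k + 1)
  | none, i => (.inr i, 0)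
  | some (l, j), _ => (l, after l j)

/-- The position of a vertex in the flow direction, the body being at `0`. -/
def position : Option ((Fin m ⊕ Fin n) × Fin k) → ℤ
  | none => 0
  | some (.inl _, j) => -(j + 1)
  | some (.inr _, j) => j + 1

variable {C : Type u} (κ : (Fin m ⊕ Fin n) × Fin (k + 1) → C)

/-- The colors of the edges at distance `j` from the body on the input side. -/
def endsIn (j : Fin (k + 1)) : Profile C := ⟨m, fun i => κ (.inl i, j)⟩

/-- The colors of the edges at distance `j` from the body on the output side. -/
def endsOut (j : Fin (k + 1)) : Profile C := ⟨n, fun i => κ (.inr i, j)⟩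

/-- The input profile of a vertex. -/
def profIn (v : Option ((Fin m ⊕ Fin n) × Fin k)) : Profile C := ⟨lenIn v, fun i => κ (inputs v i)⟩

/-- The output profile of a vertex. -/
def profOut (v : Option ((Fin m ⊕ Fin n) × Fin k)) : Profile C :=
  ⟨lenOut v, fun i => κ (outputs v i)⟩

theorem position_lt {v w : Option ((Fin m ⊕ Fin n) × Fin k)} {a b} (h : outputs v a = inputs w b) :
    position v < position w := by
  match v, w, a, b, h with
  | none, none, a, b, h => simp [outputs, inputs] at h
  | none, some (.inl i, j), a, b, h => simp [outputs, inputs] at h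
  | none, some (.inr i, j), a, b, h => simp only [position]; omega
  | some (.inr i, j), none, a, b, h => simp [outputs, inputs] at h
  | some (.inl i, j), none, a, b, h => simp only [position]; omega
  | some (.inl i, j), some (.inr i', j'), a, b, h => simp [outputs, inputs] at h
  | some (.inr i, j), some (.inl i', j'), a, b, h => simp [outputs, inputs] at h
  | some (.inl i, j), some (.inl i', j'), a, b, h =>
    simp only [outputs, inputs, before, after, Prod.mk.injEq, Fin.ext_iff, Fin.val_castSucc,
      Fin.val_succ] at h
    simp only [position]; omega
  | some (.inr i, j), some (.inr i', j'), a, b, h =>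
    simp only [outputs, inputs, before, after, Prod.mk.injEq, Fin.ext_iff, Fin.val_castSucc,
      Fin.val_succ] at h
    simp only [position]; omega

end Spider

open Spider

/-- The spider: a tree consisting of a vertex, its body, with `m` inputs and `n` outputs, and a leg
at each of them, a linear graph with `k` vertices. The edges of each leg are numbered by `0, …, k`,
its vertices by `0, …, k - 1`, starting at the body. The profiles are defined through the coloring
of the edges, so that applying a map of colors commutes with the construction by definition. -/
def spider {m n k : ℕ} {C : Type u} (κ : (Fin m ⊕ Fin n) × Fin (k + 1) → C) :
    ColoredGraph (profIn κ) (profOut κ) (endsIn κ (Fin.last k)) (endsOut κ (Fin.last k)) where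
  Edge := (Fin m ⊕ Fin n) × Fin (k + 1)
  color := κ
  inp i := (.inl i, Fin.last k)
  out i := (.inr i, Fin.last k)
  vinp := inputs
  vout := outputs
  color_inp _ := rfl
  color_out _ := rfl
  color_vinp _ _ := rfl
  color_vout _ _ := rfl
  source_bijective := by
    refine ⟨?_, ?_⟩
    · rintro (i | ⟨_ | ⟨i | i, j⟩, a⟩) (i' | ⟨_ | ⟨i' | i', j'⟩, a'⟩) h
      all_goals
        simp only [Sum.elim_inl, Sum.elim_inr, outputs, after, Prod.mk.injEq,
          Sum.inl.injEq, Sum.inr.injEq, reduceCtorEq, false_and, Fin.ext_iff, Fin.val_last,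
          Fin.val_castSucc, Fin.val_succ, Fin.val_zero] at h <;>
        first
          | exact h.elim
          | obtain ⟨h, h'⟩ := h
            first
              | exact h'.elim
              | omega
              | cases h; rfl
              | obtain rfl := Fin.ext h
                obtain rfl : j = j' := Fin.ext (by omega)
                obtain rfl : a = a' := Subsingleton.elim (α := Fin 1) _ _
                rfl
    · rintro ⟨i | i, j⟩
      · rcases Fin.eq_castSucc_or_eq_last j with ⟨j, rfl⟩ | rfl
        · exact ⟨.inr ⟨some (.inl i, j), (0 : Fin 1)⟩, rfl⟩
        · exact ⟨.inl i, rfl⟩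
      · rcases Fin.eq_zero_or_eq_succ j with rfl | ⟨j, rfl⟩
        · exact ⟨.inr ⟨none, i⟩, rfl⟩
        · exact ⟨.inr ⟨some (.inr i, j), (0 : Fin 1)⟩, rfl⟩
  target_bijective := by
    refine ⟨?_, ?_⟩
    · rintro (i | ⟨_ | ⟨i | i, j⟩, a⟩) (i' | ⟨_ | ⟨i' | i', j'⟩, a'⟩) h
      all_goals
        simp only [Sum.elim_inl, Sum.elim_inr, inputs, before, Prod.mk.injEq,
          Sum.inl.injEq, Sum.inr.injEq, reduceCtorEq, false_and, Fin.ext_iff, Fin.val_last,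
          Fin.val_castSucc, Fin.val_succ, Fin.val_zero] at h <;>
        first
          | exact h.elim
          | obtain ⟨h, h'⟩ := h
            first
              | exact h'.elim
              | omega
              | cases h; rfl
              | obtain rfl := Fin.ext h
                obtain rfl : j = j' := Fin.ext (by omega)
                obtain rfl : a = a' := Subsingleton.elim (α := Fin 1) _ _
                rfl
    · rintro ⟨i | i, j⟩
      · rcases Fin.eq_zero_or_eq_succ j with rfl | ⟨j, rfl⟩
        · exact ⟨.inr ⟨none, i⟩, rfl⟩
        · exact ⟨.inr ⟨some (.inl i, j), (0 : Fin 1)⟩, rfl⟩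
      · rcases Fin.eq_castSucc_or_eq_last j with ⟨j, rfl⟩ | rfl
        · exact ⟨.inr ⟨some (.inr i, j), (0 : Fin 1)⟩, rfl⟩
        · exact ⟨.inl i, rfl⟩
  acyclic v h := by
    have key : ∀ w, Relation.TransGen (fun v w => ∃ a b, outputs v a = inputs w b) v w →
        position v < position w := by
      intro w hw
      induction hw with
      | single h =>
        obtain ⟨a, b, h⟩ := h
        exact position_lt h
      | tail _ h ih =>
        obtain ⟨a, b, h⟩ := h
        exact ih.trans (position_lt h)
    exact lt_irrefl _ (key v h)

theorem spider_isTree {m n k : ℕ} {C : Type u} (κ : (Fin m ⊕ Fin n) × Fin (k + 1) → C) :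
    (spider κ).incidence.IsTree := by
  have h1 : ∀ l (j : Fin k),
      (spider κ).incidence.Adj (.inl (some (l, j))) (.inr (l, j.castSucc)) := by
    rintro (i | i) j
    exacts [.inr ⟨(0 : Fin 1), rfl⟩, .inl ⟨(0 : Fin 1), rfl⟩]
  have h2 : ∀ l (j : Fin k), (spider κ).incidence.Adj (.inl (some (l, j))) (.inr (l, j.succ)) := by
    rintro (i | i) j
    exacts [.inl ⟨(0 : Fin 1), rfl⟩, .inr ⟨(0 : Fin 1), rfl⟩]
  have h0 : ∀ l, (spider κ).incidence.Adj (.inl none) (.inr (l, 0)) := by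
    rintro (i | i)
    exacts [.inl ⟨i, rfl⟩, .inr ⟨i, rfl⟩]
  have inc0 : ∀ l j, (spider κ).Incident none (l, j) → j = 0 := by
    rintro l j (⟨_, h⟩ | ⟨_, h⟩)
    exacts [(congrArg Prod.snd h).symm, (congrArg Prod.snd h).symm]
  have inc : ∀ l j l' j', (spider κ).Incident (some (l, j)) (l', j') →
      l = l' ∧ ((j' : ℕ) = j ∨ (j' : ℕ) = j + 1) := by
    rintro (i | i) j l' j' (⟨_, h⟩ | ⟨_, h⟩)
    all_goals
      obtain rfl := congrArg Prod.fst h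
      obtain rfl := congrArg Prod.snd h
    exacts [⟨rfl, .inr rfl⟩, ⟨rfl, .inl rfl⟩, ⟨rfl, .inl rfl⟩, ⟨rfl, .inr rfl⟩]
  -- The height of a vertex or an edge is its distance from the body.
  refine ⟨?_, isAcyclic_of_height _ (Sum.elim
    (fun v => v.elim 0 fun p => 2 * (p.2 : ℕ) + 2)
    fun e : (Fin m ⊕ Fin n) × Fin (k + 1) => 2 * (e.2 : ℕ) + 1) ?_⟩
  · rw [SimpleGraph.connected_iff_exists_forall_reachable]
    have h3 : ∀ l j, (spider κ).incidence.Reachable (.inl none) (.inr (l, j)) := by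
      intro l j
      induction j using Fin.induction with
      | zero => exact (h0 l).reachable
      | succ j ih => exact (ih.trans (h1 l j).symm.reachable).trans (h2 l j).reachable
    refine ⟨.inl none, ?_⟩
    rintro ((_ | ⟨l, j⟩) | ⟨l, j⟩)
    exacts [.refl _, (h3 _ _).trans (h1 l j).symm.reachable, h3 l j]
  · rintro ((_ | ⟨l, j⟩) | ⟨l, j⟩) ((_ | ⟨l', j'⟩) | ⟨l', j'⟩) ((_ | ⟨l'', j''⟩) | ⟨l'', j''⟩)
      h h' hl hm
    all_goals first | exact h.elim | exact h'.elim | skip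
    · replace hl : 2 * (j' : ℕ) + 1 ≤ 0 := hl
      omega
    · replace hl : 2 * (j' : ℕ) + 1 ≤ 2 * (j : ℕ) + 2 := hl
      replace hm : 2 * (j'' : ℕ) + 1 ≤ 2 * (j : ℕ) + 2 := hm
      obtain ⟨rfl, h⟩ := inc _ _ _ _ h
      obtain ⟨rfl, h'⟩ := inc _ _ _ _ h'
      obtain rfl : j' = j'' := Fin.ext (by omega)
      rfl
    · rfl
    · replace hm : 2 * (j'' : ℕ) + 2 ≤ 2 * (j : ℕ) + 1 := hm
      obtain rfl := inc0 _ _ h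
      rw [Fin.val_zero] at hm
      omega
    · replace hl : 2 * (j' : ℕ) + 2 ≤ 2 * (j : ℕ) + 1 := hl
      obtain rfl := inc0 _ _ h'
      rw [Fin.val_zero] at hl
      omega
    · replace hl : 2 * (j' : ℕ) + 2 ≤ 2 * (j : ℕ) + 1 := hl
      replace hm : 2 * (j'' : ℕ) + 2 ≤ 2 * (j : ℕ) + 1 := hm
      obtain ⟨rfl, h⟩ := inc _ _ _ _ h
      obtain ⟨rfl, h'⟩ := inc _ _ _ _ h'
      obtain rfl : j' = j'' := Fin.ext (by omega)
      rfl

end ColoredGraph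

/-! ### The action of unary operations on biprofiles -/

section
open scoped Simplicial

/-- The components of a product of simplicial sets over a finite set are determined by the
components of the factors. -/
theorem decorations_mk_eq_mk {C : Type u} {P : Profile C → Profile C → SSet.{v}} {V : Type}
    [Finite V] {s t : V → Profile C} (a b : (decorations P s t) _⦋0⦌)
    (h : ∀ v, SSet.π₀.mk (a v) = SSet.π₀.mk (b v)) : SSet.π₀.mk a = SSet.π₀.mk b := by
  classical
  have := Fintype.ofFinite V
  -- Components of a product do not change if one coordinate moves within its component.
  have step (a : (decorations P s t) _⦋0⦌) (v : V) (y : (P (s v) (t v)) _⦋0⦌)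
      (h : SSet.π₀.mk (a v) = SSet.π₀.mk y) :
      SSet.π₀.mk a = SSet.π₀.mk (X := decorations P s t) (Function.update a v y) := by
    let φ : SSet.π₀ (P (s v) (t v)) → SSet.π₀ (decorations P s t) :=
      SSet.π₀.lift (fun y => SSet.π₀.mk (X := decorations P s t) (Function.update a v y))
        fun y₀ y₁ e => SSet.π₀.sound (SSet.Edge.mk
          (Function.update (fun w => (SSet.Edge.id (a w)).edge) v e.edge :
            (decorations P s t) _⦋1⦌)
          (funext fun w => (Function.apply_update (fun w => (P (s w) (t w)).δ 1) _ _ _ _).trans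
            (by rw [e.src_eq]; simp only [SSet.Edge.src_eq]))
          (funext fun w => (Function.apply_update (fun w => (P (s w) (t w)).δ 0) _ _ _ _).trans
            (by rw [e.tgt_eq]; simp only [SSet.Edge.tgt_eq])))
    have hφ := congrArg φ h
    change SSet.π₀.mk (X := decorations P s t) (Function.update a v (a v)) =
      SSet.π₀.mk (X := decorations P s t) (Function.update a v y) at hφ
    rwa [Function.update_eq_self] at hφ
  have key (S : Finset V) :
      SSet.π₀.mk a = SSet.π₀.mk (X := decorations P s t) (S.piecewise b a) := by
    induction S using Finset.induction_on with
    | empty => rw [Finset.piecewise_empty]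
    | insert v S hv ih =>
      rw [ih, Finset.piecewise_insert]
      refine step _ v (b v) ?_
      rw [Finset.piecewise_eq_of_notMem _ _ _ hv]
      exact h v
  rw [key Finset.univ, Finset.piecewise_univ]

end

namespace SimplicialGrProp

variable {𝒢 : GraphGroupoid} (P : SimplicialGrProp.{u, v} 𝒢)

/-- Compatibility of composition with graph substitution, when the profiles of the vertices of the
graphs `H v` agree with those of the corresponding vertices of `K` only up to propositional
equality. -/
theorem comp_substitution_of_eq {V U : Type} [Finite V] [Finite U] {W : V → Type}
    [∀ v, Finite (W v)] (ι : ∀ v, W v → U) {s t : V → Profile P.Col} {a b : U → Profile P.Col}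
    {a' b' : ∀ v, W v → Profile P.Col} {c d : Profile P.Col}
    (ha : ∀ v w, a' v w = a (ι v w)) (hb : ∀ v w, b' v w = b (ι v w))
    {G : ColoredGraph s t c d} {H : ∀ v, ColoredGraph (a' v) (b' v) (s v) (t v)}
    {K : ColoredGraph a b c d}
    (bijective : Function.Bijective fun p : Σ v, W v => ι p.1 p.2)
    (outer : G.Edge → K.Edge) (inner : ∀ v, (H v).Edge → K.Edge)
    (color_outer : ∀ e, K.color (outer e) = G.color e)
    (color_inner : ∀ v e, K.color (inner v e) = (H v).color e)
    (glue_inp : ∀ v i, inner v ((H v).inp i) = outer (G.vinp v i))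
    (glue_out : ∀ v j, inner v ((H v).out j) = outer (G.vout v j))
    (inp_eq : ∀ i, K.inp i = outer (G.inp i))
    (out_eq : ∀ j, K.out j = outer (G.out j))
    (vinp_eq : ∀ v w i, K.vinp (ι v w) (Fin.cast (congrArg Profile.len (ha v w)) i) =
      inner v ((H v).vinp w i))
    (vout_eq : ∀ v w j, K.vout (ι v w) (Fin.cast (congrArg Profile.len (hb v w)) j) =
      inner v ((H v).vout w j))
    (hG : 𝒢.Mem G) (hH : ∀ v, 𝒢.Mem (H v)) (hK : 𝒢.Mem K) (N : SimplexCategoryᵒᵖ)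
    (x : ∀ u, (P.obj (a u) (b u)).obj N) (x' : ∀ v w, (P.obj (a' v w) (b' v w)).obj N)
    (hx : ∀ v w, x' v w ≍ x (ι v w)) :
    (P.comp K hK).app N x = (P.comp G hG).app N fun v => (P.comp (H v) (hH v)).app N (x' v) := by
  obtain rfl : a' = fun v w => a (ι v w) := funext₂ ha
  obtain rfl : b' = fun v w => b (ι v w) := funext₂ hb
  obtain rfl : x' = fun v w => x (ι v w) := funext₂ fun v w => eq_of_heq (hx v w)
  exact P.comp_substitution ⟨bijective, outer, inner, color_outer, color_inner, glue_inp, glue_out,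
    inp_eq, out_eq, vinp_eq, vout_eq⟩ hG hH hK N x

end SimplicialGrProp

namespace SimplicialGrProp

open ColoredGraph ColoredGraph.Spider

variable {𝒢 : GraphGroupoid} (P : SimplicialGrProp.{u, v} 𝒢) {m n k : ℕ}

/-- The decorations of the legs of a spider. -/
abbrev legs (κ : (Fin m ⊕ Fin n) × Fin (k + 1) → P.Col) : SSet.{v} :=
  decorations P.obj (fun p : (Fin m ⊕ Fin n) × Fin k => profIn κ (some p))
    fun p => profOut κ (some p)

/-- Decorations of the body and of the legs of a spider, combined. -/
def attach {κ : (Fin m ⊕ Fin n) × Fin (k + 1) → P.Col} {N : SimplexCategoryᵒᵖ}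
    (x : (P.obj (endsIn κ 0) (endsOut κ 0)).obj N) (α : (P.legs κ).obj N) :
    (decorations P.obj (profIn κ) (profOut κ)).obj N
  | none => x
  | some p => α p

/-- The composition along a spider, as an operation of the decorations of the legs on those of the
body. -/
def graft (κ : (Fin m ⊕ Fin n) × Fin (k + 1) → P.Col) :
    P.obj (endsIn κ 0) (endsOut κ 0) ⊗ P.legs κ ⟶
      P.obj (endsIn κ (Fin.last k)) (endsOut κ (Fin.last k)) :=
  { app := fun N => ↾fun p => P.attach p.1 p.2
    naturality := fun N M f => by
      ext p v
      match v with
      | none => rfl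
      | some p => rfl } ≫ P.comp (spider κ) (𝒢.mem_of_isTree (spider_isTree κ))

theorem graft_app {κ : (Fin m ⊕ Fin n) × Fin (k + 1) → P.Col} {N : SimplexCategoryᵒᵖ}
    (x : (P.obj (endsIn κ 0) (endsOut κ 0)).obj N) (α : (P.legs κ).obj N) :
    (P.graft κ).app N (x, α) =
      (P.comp (spider κ) (𝒢.mem_of_isTree (spider_isTree κ))).app N (P.attach x α) := rfl

/-- The coloring of a spider with legs of length one, with edges of color `x l` at the body and of
color `y l` at the end of the leg `l`. -/
def colors {C : Type u} (x y : Fin m ⊕ Fin n → C) (e : (Fin m ⊕ Fin n) × Fin 2) : C :=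
  ![x e.1, y e.1] e.2

/-- The coloring of a spider with legs of length two. -/
def colors₂ {C : Type u} (x y z : Fin m ⊕ Fin n → C) (e : (Fin m ⊕ Fin n) × Fin 3) : C :=
  ![x e.1, y e.1, z e.1] e.2

/-- The units, as decorations of the legs of a spider. -/
def unitLegs (x : Fin m ⊕ Fin n → P.Col) (N : SimplexCategoryᵒᵖ) : (P.legs (colors x x)).obj N
  | (.inl i, 0) => (P.unit (x (.inl i))).app N PUnit.unit
  | (.inr i, 0) => (P.unit (x (.inr i))).app N PUnit.unit

/-- Units act trivially: substituting exceptional edges for the legs of a spider leaves a corolla.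
-/
theorem graft_unitLegs (x : Fin m ⊕ Fin n → P.Col) (N : SimplexCategoryᵒᵖ)
    (f : (P.obj (endsIn (colors x x) 0) (endsOut (colors x x) 0)).obj N) :
    (P.graft (colors x x)).app N (f, P.unitLegs x N) = f := by
  let W : Option ((Fin m ⊕ Fin n) × Fin 1) → Type
    | none => Unit
    | some _ => Empty
  have : ∀ v, Finite (W v)
    | none => inferInstanceAs (Finite Unit)
    | some _ => inferInstanceAs (Finite Empty)
  let c := endsIn (colors x x) 0
  let d := endsOut (colors x x) 0
  let H : ∀ v, ColoredGraph (fun _ : W v => c) (fun _ : W v => d) (profIn (colors x x) v)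
      (profOut (colors x x) v)
    | none => corolla c d
    | some (.inl i, 0) => exceptional (V := Empty) _ _ (x (.inl i))
    | some (.inr i, 0) => exceptional (V := Empty) _ _ (x (.inr i))
  have hH : ∀ v, 𝒢.Mem (H v)
    | none => 𝒢.mem_of_isTree (corolla_isTree _ _)
    | some (.inl i, 0) => 𝒢.mem_of_isTree (exceptional_isTree (V := Empty) _ _ _)
    | some (.inr i, 0) => 𝒢.mem_of_isTree (exceptional_isTree (V := Empty) _ _ _)
  let S : Substitution (fun v (_ : W v) => ()) (spider (colors x x)) H (corolla c d) :=
    { bijective := by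
        refine ⟨?_, fun _ => ⟨⟨none, ()⟩, rfl⟩⟩
        rintro ⟨_ | _, w⟩ ⟨_ | _, w'⟩ -
        exacts [rfl, w'.elim, w.elim, w.elim]
      outer := fun e => e.1
      inner := fun v => match v with
        | none => id
        | some (.inl i, 0) => fun _ => .inl i
        | some (.inr i, 0) => fun _ => .inr i
      color_outer := by
        rintro ⟨i | i, j⟩ <;> fin_cases j <;> rfl
      color_inner := fun v e => match v with
        | none => rfl
        | some (.inl i, 0) => rfl
        | some (.inr i, 0) => rfl
      glue_inp := fun v i => match v with
        | none => rfl
        | some (.inl i, 0) => rfl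
        | some (.inr i, 0) => rfl
      glue_out := fun v i => match v with
        | none => rfl
        | some (.inl i, 0) => rfl
        | some (.inr i, 0) => rfl
      inp_eq := fun i => rfl
      out_eq := fun i => rfl
      vinp_eq := fun v w i => match v, w with
        | none, _ => rfl
        | some _, w => w.elim
      vout_eq := fun v w i => match v, w with
        | none, _ => rfl
        | some _, w => w.elim }
  have h := P.comp_substitution S (𝒢.mem_of_isTree (spider_isTree _)) hH
    (𝒢.mem_of_isTree (corolla_isTree _ _)) N (fun _ => f)
  rw [graft_app]
  refine Eq.trans (congrArg ((P.comp (spider (colors x x)) _).app N) (funext fun v => ?_))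
    (h.symm.trans (P.comp_corolla _ _ N f))
  match v with
  | none => exact (P.comp_corolla _ _ N f).symm
  | some (.inl i, 0) => exact (P.comp_exceptional _ (V := Empty) _ _ _ _ _).symm
  | some (.inr i, 0) => exact (P.comp_exceptional _ (V := Empty) _ _ _ _ _).symm

end SimplicialGrProp

/-! ### Composition of the actions of unary operations -/

namespace SimplicialGrProp

open ColoredGraph ColoredGraph.Spider

variable {𝒢 : GraphGroupoid} (P : SimplicialGrProp.{u, v} 𝒢) {m n : ℕ}

variable {x y z : Fin m ⊕ Fin n → P.Col}

/-- The composition of unary operations on the legs of a spider. -/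
def compLegs {N : SimplexCategoryᵒᵖ} (α : (P.legs (colors x y)).obj N)
    (β : (P.legs (colors y z)).obj N) : (P.legs (colors x z)).obj N
  | (.inl i, 0) => (P.unaryComp (z (.inl i)) (y (.inl i)) (x (.inl i))).app N
      (β (.inl i, 0), α (.inl i, 0))
  | (.inr i, 0) => (P.unaryComp (x (.inr i)) (y (.inr i)) (z (.inr i))).app N
      (α (.inr i, 0), β (.inr i, 0))

/-- Decorations of the two halves of the legs of a spider, combined. -/
def joinLegs {N : SimplexCategoryᵒᵖ} (α : (P.legs (colors x y)).obj N)
    (β : (P.legs (colors y z)).obj N) : (P.legs (colors₂ x y z)).obj N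
  | (.inl i, 0) => α (.inl i, 0)
  | (.inr i, 0) => α (.inr i, 0)
  | (.inl i, 1) => β (.inl i, 0)
  | (.inr i, 1) => β (.inr i, 0)

/-- The spider with legs of length two arises by substituting a spider with legs of length one for
the body of another one. -/
theorem graft_joinLegs_eq_graft_graft {N : SimplexCategoryᵒᵖ}
    (f : (P.obj (endsIn (colors x y) 0) (endsOut (colors x y) 0)).obj N)
    (α : (P.legs (colors x y)).obj N) (β : (P.legs (colors y z)).obj N) :
    (P.graft (colors₂ x y z)).app N (f, P.joinLegs α β) =
      (P.graft (colors y z)).app N ((P.graft (colors x y)).app N (f, α), β) := by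
  let W : Option ((Fin m ⊕ Fin n) × Fin 1) → Type
    | none => Option ((Fin m ⊕ Fin n) × Fin 1)
    | some _ => Unit
  have : ∀ v, Finite (W v)
    | none => inferInstanceAs (Finite (Option ((Fin m ⊕ Fin n) × Fin 1)))
    | some _ => inferInstanceAs (Finite Unit)
  let ι : ∀ v, W v → Option ((Fin m ⊕ Fin n) × Fin 2)
    | none, none => none
    | none, some (l, j) => some (l, j.castSucc)
    | some (l, j), _ => some (l, j.succ)
  let a' : ∀ v, W v → Profile P.Col
    | none => profIn (colors x y)
    | some p => fun _ => profIn (colors y z) (some p)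
  let b' : ∀ v, W v → Profile P.Col
    | none => profOut (colors x y)
    | some p => fun _ => profOut (colors y z) (some p)
  let H : ∀ v, ColoredGraph (a' v) (b' v) (profIn (colors y z) v) (profOut (colors y z) v)
    | none => spider (colors x y)
    | some p => corolla _ _
  have hH : ∀ v, 𝒢.Mem (H v)
    | none => 𝒢.mem_of_isTree (spider_isTree _)
    | some p => 𝒢.mem_of_isTree (corolla_isTree _ _)
  let F : ∀ v w, (P.obj (a' v w) (b' v w)).obj N
    | none => P.attach f α
    | some p => fun _ => β p
  refine (P.comp_substitution_of_eq ι ?_ ?_ (G := spider (colors y z)) (H := H)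
    (K := spider (colors₂ x y z)) ?_ (fun e => (e.1, e.2.succ))
    (fun v => match v with
      | none => fun e => (e.1, e.2.castSucc)
      | some (l, j) => Sum.elim (fun _ => (l, (before l j).succ)) (fun _ => (l, (after l j).succ)))
    ?_ ?_ ?_ ?_ ?_ ?_ ?_ ?_ (𝒢.mem_of_isTree (spider_isTree _)) hH _ N
    (P.attach (κ := colors₂ x y z) f (P.joinLegs α β)) F ?_).trans ?_
  · rintro (_ | ⟨i | i, j⟩) w
    · rcases w with _ | ⟨i | i, j⟩
      · rfl
      · fin_cases j; rfl
      · fin_cases j; rfl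
    · fin_cases j; rfl
    · fin_cases j; rfl
  · rintro (_ | ⟨i | i, j⟩) w
    · rcases w with _ | ⟨i | i, j⟩
      · rfl
      · fin_cases j; rfl
      · fin_cases j; rfl
    · fin_cases j; rfl
    · fin_cases j; rfl
  · refine ⟨?_, ?_⟩
    · rintro ⟨_ | ⟨l, j⟩, w⟩ ⟨_ | ⟨l', j'⟩, w'⟩ h
      · rcases w with _ | ⟨l, j⟩ <;> rcases w' with _ | ⟨l', j'⟩
        · rfl
        · cases h
        · cases h
        · obtain ⟨rfl, -⟩ := Prod.mk.injEq .. ▸ Option.some_injective _ h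
          obtain rfl := Subsingleton.elim j j'
          rfl
      · rcases w with _ | ⟨l, j⟩
        · cases h
        · fin_cases j; fin_cases j'; cases h
      · rcases w' with _ | ⟨l', j'⟩
        · cases h
        · fin_cases j; fin_cases j'; cases h
      · obtain ⟨rfl, -⟩ := Prod.mk.injEq .. ▸ Option.some_injective _ h
        obtain rfl := Subsingleton.elim j j'
        rfl
    · rintro (_ | ⟨l, j⟩)
      · exact ⟨⟨none, none⟩, rfl⟩
      · fin_cases j
        · exact ⟨⟨none, some (l, 0)⟩, rfl⟩
        · exact ⟨⟨some (l, 0), ()⟩, rfl⟩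
  · rintro ⟨l, j⟩
    fin_cases j <;> rfl
  · rintro (_ | ⟨i | i, j⟩) e
    · obtain ⟨l, j⟩ := e
      fin_cases j <;> rfl
    · fin_cases j
      rcases e with e | e <;> rfl
    · fin_cases j
      rcases e with e | e <;> rfl
  · rintro (_ | ⟨i | i, j⟩) e <;> rfl
  · rintro (_ | ⟨i | i, j⟩) e <;> rfl
  · intro i
    rfl
  · intro i
    rfl
  · rintro (_ | ⟨i | i, j⟩) w e
    · rcases w with _ | ⟨i | i, j⟩
      all_goals rfl
    all_goals rfl
  · rintro (_ | ⟨i | i, j⟩) w e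
    · rcases w with _ | ⟨i | i, j⟩
      all_goals rfl
    all_goals rfl
  · rintro (_ | ⟨i | i, j⟩) w
    · rcases w with _ | ⟨i | i, j⟩
      · rfl
      · fin_cases j; rfl
      · fin_cases j; rfl
    · fin_cases j; rfl
    · fin_cases j; rfl
  · refine congrArg ((P.comp (spider (colors y z)) (𝒢.mem_of_isTree (spider_isTree _))).app N)
      (funext fun v => ?_)
    match v with
    | none => rfl
    | some p => exact P.comp_corolla _ _ N (β p)

/-- The spider with legs of length two arises by substituting linear graphs for the vertices of the
legs of a spider with legs of length one. -/
theorem graft_joinLegs_eq_graft_compLegs {N : SimplexCategoryᵒᵖ}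
    (f : (P.obj (endsIn (colors x y) 0) (endsOut (colors x y) 0)).obj N)
    (α : (P.legs (colors x y)).obj N) (β : (P.legs (colors y z)).obj N) :
    (P.graft (colors₂ x y z)).app N (f, P.joinLegs α β) =
      (P.graft (colors x z)).app N (f, P.compLegs α β) := by
  let W : Option ((Fin m ⊕ Fin n) × Fin 1) → Type
    | none => Unit
    | some _ => Fin 2
  have : ∀ v, Finite (W v)
    | none => inferInstanceAs (Finite Unit)
    | some _ => inferInstanceAs (Finite (Fin 2))
  -- The linear graph replacing a leg on the input side is directed towards the body.
  let ι : ∀ v, W v → Option ((Fin m ⊕ Fin n) × Fin 2)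
    | none, _ => none
    | some (.inl i, _), w => some (.inl i, Fin.rev (n := 2) w)
    | some (.inr i, _), w => some (.inr i, w)
  let κ : Fin m ⊕ Fin n → Fin 3 → P.Col
    | .inl i => ![z (.inl i), y (.inl i), x (.inl i)]
    | .inr i => ![x (.inr i), y (.inr i), z (.inr i)]
  let a' : ∀ v, W v → Profile P.Col
    | none => fun _ => profIn (colors x z) none
    | some (l, _) => fun w : Fin 2 => Profile.single (κ l w.castSucc)
  let b' : ∀ v, W v → Profile P.Col
    | none => fun _ => profOut (colors x z) none
    | some (l, _) => fun w : Fin 2 => Profile.single (κ l w.succ)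
  let H : ∀ v, ColoredGraph (a' v) (b' v) (profIn (colors x z) v) (profOut (colors x z) v)
    | none => corolla _ _
    | some (.inl i, 0) => linear 2 (κ (.inl i))
    | some (.inr i, 0) => linear 2 (κ (.inr i))
  have hH : ∀ v, 𝒢.Mem (H v)
    | none => 𝒢.mem_of_isTree (corolla_isTree _ _)
    | some (.inl i, 0) => 𝒢.mem_of_isTree (linear_isTree 2 _)
    | some (.inr i, 0) => 𝒢.mem_of_isTree (linear_isTree 2 _)
  let F : ∀ v w, (P.obj (a' v w) (b' v w)).obj N
    | none => fun _ => f
    | some (.inl i, 0) => fun w => match (w : Fin 2) with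
      | 0 => β (.inl i, 0)
      | 1 => α (.inl i, 0)
    | some (.inr i, 0) => fun w => match (w : Fin 2) with
      | 0 => α (.inr i, 0)
      | 1 => β (.inr i, 0)
  refine (P.comp_substitution_of_eq ι ?_ ?_ (G := spider (colors x z)) (H := H)
    (K := spider (colors₂ x y z)) ?_ (fun e => (e.1, ![0, 2] e.2))
    (fun v => match v with
      | none => Sum.elim (fun i => (.inl i, 0)) (fun i => (.inr i, 0))
      | some (.inl i, 0) => fun e => (.inl i, Fin.rev (n := 3) e)
      | some (.inr i, 0) => fun e => (.inr i, e))
    ?_ ?_ ?_ ?_ ?_ ?_ ?_ ?_ (𝒢.mem_of_isTree (spider_isTree _)) hH _ N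
    (P.attach (κ := colors₂ x y z) f (P.joinLegs α β)) F ?_).trans ?_
  · rintro (_ | ⟨i | i, j⟩) w
    · rfl
    all_goals
      change Fin 2 at w
      fin_cases j
      fin_cases w <;> rfl
  · rintro (_ | ⟨i | i, j⟩) w
    · rfl
    all_goals
      change Fin 2 at w
      fin_cases j
      fin_cases w <;> rfl
  · refine ⟨?_, ?_⟩
    · rintro ⟨_ | ⟨i | i, j⟩, w⟩ ⟨_ | ⟨i' | i', j'⟩, w'⟩ h
      · rfl
      all_goals first | cases h; done | skip
      · obtain ⟨h, h'⟩ := Prod.mk.injEq .. ▸ Option.some_injective _ h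
        obtain rfl := Sum.inl_injective h
        obtain rfl := Subsingleton.elim j j'
        obtain rfl := Fin.rev_injective h'
        rfl
      · obtain ⟨h, h'⟩ := Prod.mk.injEq .. ▸ Option.some_injective _ h
        obtain rfl := Sum.inr_injective h
        obtain rfl := Subsingleton.elim j j'
        obtain rfl := h'
        rfl
    · rintro (_ | ⟨i | i, j⟩)
      · exact ⟨⟨none, ()⟩, rfl⟩
      · refine ⟨⟨some (.inl i, 0), Fin.rev j⟩, ?_⟩
        fin_cases j <;> rfl
      · exact ⟨⟨some (.inr i, 0), j⟩, rfl⟩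
  · rintro ⟨i | i, j⟩ <;> fin_cases j <;> rfl
  · rintro (_ | ⟨i | i, j⟩) e
    · rcases e with e | e <;> rfl
    all_goals
      fin_cases j
      change Fin 3 at e
      fin_cases e <;> rfl
  · rintro (_ | ⟨i | i, j⟩) e
    · rfl
    all_goals fin_cases j; rfl
  · rintro (_ | ⟨i | i, j⟩) e
    · rfl
    all_goals fin_cases j; rfl
  · intro i
    rfl
  · intro i
    rfl
  · rintro (_ | ⟨i | i, j⟩) w e
    · rfl
    all_goals
      change Fin 2 at w
      fin_cases j
      fin_cases w <;> rfl
  · rintro (_ | ⟨i | i, j⟩) w e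
    · rfl
    all_goals
      change Fin 2 at w
      fin_cases j
      fin_cases w <;> rfl
  · rintro (_ | ⟨i | i, j⟩) w
    · rfl
    all_goals
      change Fin 2 at w
      fin_cases j
      fin_cases w <;> rfl
  · refine congrArg ((P.comp (spider (colors x z)) (𝒢.mem_of_isTree (spider_isTree _))).app N)
      (funext fun v => ?_)
    match v with
    | none => exact P.comp_corolla _ _ N f
    | some (.inl i, 0) => exact P.comp_linear_two (κ (.inl i)) _ N _
    | some (.inr i, 0) => exact P.comp_linear_two (κ (.inr i)) _ N _

/-- Acting by two sets of unary operations is acting by their composites. -/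
theorem graft_graft {N : SimplexCategoryᵒᵖ}
    (f : (P.obj (endsIn (colors x y) 0) (endsOut (colors x y) 0)).obj N)
    (α : (P.legs (colors x y)).obj N) (β : (P.legs (colors y z)).obj N) :
    (P.graft (colors y z)).app N ((P.graft (colors x y)).app N (f, α), β) =
      (P.graft (colors x z)).app N (f, P.compLegs α β) :=
  (P.graft_joinLegs_eq_graft_graft f α β).symm.trans (P.graft_joinLegs_eq_graft_compLegs f α β)

end SimplicialGrProp

/-! ### Invertible unary operations and cancellation on the left -/

namespace SimplicialGrProp

open ColoredGraph ColoredGraph.Spider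
open scoped Simplicial

variable {𝒢 : GraphGroupoid} {P : SimplicialGrProp.{u, v} 𝒢} {m n : ℕ}

/-- The vertex `α` of the simplicial set of decorations of the legs of a spider represents the given
isomorphisms in the category of components. As the legs on the input side are directed towards the
body, they are decorated by representatives of the inverses. -/
def Represents (κ : (Fin m ⊕ Fin n) × Fin 2 → P.Col)
    (e : ∀ l, (⟨κ (l, 0)⟩ : SCat.PiZero P.underlying) ≅ ⟨κ (l, 1)⟩) (α : (P.legs κ) _⦋0⦌) : Prop :=
  (∀ i, SSet.π₀.mk (α (.inl i, 0)) = (e (.inl i)).inv) ∧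
    ∀ i, SSet.π₀.mk (α (.inr i, 0)) = (e (.inr i)).hom

theorem exists_represents (κ : (Fin m ⊕ Fin n) × Fin 2 → P.Col)
    (e : ∀ l, (⟨κ (l, 0)⟩ : SCat.PiZero P.underlying) ≅ ⟨κ (l, 1)⟩) :
    ∃ α, Represents κ e α := by
  choose a ha using fun i => SSet.π₀.mk_surjective (e (.inl i)).inv
  choose b hb using fun i => SSet.π₀.mk_surjective (e (.inr i)).hom
  refine ⟨fun p => match p with
    | (.inl i, 0) => a i
    | (.inr i, 0) => b i, ha, hb⟩

theorem map_unaryComp (x y z : P.Col) {N M : SimplexCategoryᵒᵖ} (φ : N ⟶ M)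
    (f : (P.obj (Profile.single x) (Profile.single y)).obj N)
    (g : (P.obj (Profile.single y) (Profile.single z)).obj N) :
    (P.obj (Profile.single x) (Profile.single z)).map φ ((P.unaryComp x y z).app N (f, g)) =
      (P.unaryComp x y z).app M ((P.obj _ _).map φ f, (P.obj _ _).map φ g) :=
  (ConcreteCategory.congr_hom ((P.unaryComp x y z).naturality φ)
    ((f, g) : (P.obj (Profile.single x) (Profile.single y) ⊗
      P.obj (Profile.single y) (Profile.single z) : SSet).obj N)).symm

theorem map_compLegs {x y z : Fin m ⊕ Fin n → P.Col} {N M : SimplexCategoryᵒᵖ} (φ : N ⟶ M)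
    (α : (P.legs (colors x y)).obj N) (β : (P.legs (colors y z)).obj N) :
    (P.legs (colors x z)).map φ (P.compLegs α β) =
      P.compLegs ((P.legs (colors x y)).map φ α) ((P.legs (colors y z)).map φ β) := by
  funext p
  match p with
  | (.inl i, 0) =>
    exact map_unaryComp (P := P) (z (.inl i)) (y (.inl i)) (x (.inl i)) φ
      (β (.inl i, 0)) (α (.inl i, 0))
  | (.inr i, 0) =>
    exact map_unaryComp (P := P) (x (.inr i)) (y (.inr i)) (z (.inr i)) φ
      (α (.inr i, 0)) (β (.inr i, 0))

theorem map_unitLegs (x : Fin m ⊕ Fin n → P.Col) {N M : SimplexCategoryᵒᵖ} (φ : N ⟶ M) :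
    (P.legs (colors x x)).map φ (P.unitLegs x N) = P.unitLegs x M := by
  funext p
  match p with
  | (.inl i, 0) => exact (NatTrans.naturality_apply (P.unit (x (.inl i))) φ PUnit.unit).symm
  | (.inr i, 0) => exact (NatTrans.naturality_apply (P.unit (x (.inr i))) φ PUnit.unit).symm

theorem slice_graft_comp {x y z : Fin m ⊕ Fin n → P.Col} (α : (P.legs (colors x y)) _⦋0⦌)
    (β : (P.legs (colors y z)) _⦋0⦌) :
    SSet.slice (P.graft (colors x y)) α ≫ SSet.slice (P.graft (colors y z)) β =
      SSet.slice (P.graft (colors x z)) (P.compLegs α β) := by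
  ext N f
  refine (P.graft_graft f ((P.legs (colors x y)).map (SimplexCategory.const N.unop ⦋0⦌ 0).op α)
    ((P.legs (colors y z)).map (SimplexCategory.const N.unop ⦋0⦌ 0).op β)).trans ?_
  rw [← map_compLegs]
  rfl

theorem slice_graft_unitLegs (x : Fin m ⊕ Fin n → P.Col) :
    SSet.slice (P.graft (colors x x)) (P.unitLegs x (op ⦋0⦌)) =
      𝟙 (P.obj (endsIn (colors x x) 0) (endsOut (colors x x) 0)) := by
  ext N f
  refine Eq.trans ?_ (P.graft_unitLegs x N f)
  rw [← map_unitLegs x (SimplexCategory.const N.unop ⦋0⦌ 0).op]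
  rfl

/-- The composites of representatives of isomorphisms with representatives of their inverses lie in
the component of the units. -/
theorem mk_compLegs {x y : Fin m ⊕ Fin n → P.Col}
    {e : ∀ l, (⟨x l⟩ : SCat.PiZero P.underlying) ≅ ⟨y l⟩} {α : (P.legs (colors x y)) _⦋0⦌}
    {β : (P.legs (colors y x)) _⦋0⦌} (hα : Represents (colors x y) e α)
    (hβ : Represents (colors y x) (fun l => (e l).symm) β) :
    SSet.π₀.mk (X := P.legs (colors x x)) (P.compLegs α β) =
      SSet.π₀.mk (P.unitLegs x (op ⦋0⦌)) := by
  have H (l) : (e l).hom ≫ (e l).inv = 𝟙 _ := (e l).hom_inv_id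
  refine decorations_mk_eq_mk _ _ fun p => ?_
  match p with
  | (.inl i, 0) =>
    have h := H (.inl i)
    rw [← hα.1 i, ← show _ = (e (.inl i)).hom from hβ.1 i] at h
    exact h
  | (.inr i, 0) =>
    have h := H (.inr i)
    rw [← hα.2 i, ← show _ = (e (.inr i)).inv from hβ.2 i] at h
    exact h

/-- The actions of representatives of inverse isomorphisms are inverse to each other after applying
`π₀ (Fun(-, Z))`. -/
theorem mapπ₀_pre_slice_comp {x y : Fin m ⊕ Fin n → P.Col}
    {e : ∀ l, (⟨x l⟩ : SCat.PiZero P.underlying) ≅ ⟨y l⟩} {α : (P.legs (colors x y)) _⦋0⦌}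
    {β : (P.legs (colors y x)) _⦋0⦌} (hα : Represents (colors x y) e α)
    (hβ : Represents (colors y x) (fun l => (e l).symm) β) (Z : SSet.{v}) :
    SSet.mapπ₀ ((MonoidalClosed.pre (SSet.slice (P.graft (colors x y)) α)).app Z) ∘
      SSet.mapπ₀ ((MonoidalClosed.pre (SSet.slice (P.graft (colors y x)) β)).app Z) = id := by
  refine (SSet.mapπ₀_pre_comp _ _ Z).symm.trans ?_
  refine (congrArg (fun φ => SSet.mapπ₀ ((MonoidalClosed.pre φ).app Z))
    (slice_graft_comp α β)).trans ?_
  refine (SSet.mapπ₀_pre_slice_congr _ (mk_compLegs hα hβ) Z).trans ?_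
  refine (congrArg (fun φ => SSet.mapπ₀ ((MonoidalClosed.pre φ).app Z))
    (slice_graft_unitLegs x)).trans ?_
  exact SSet.mapπ₀_pre_id _ Z

/-- Composition with unary operations which are invertible up to homotopy, at all inputs and
outputs, is a weak homotopy equivalence: the inverses yield an inverse up to homotopy. -/
theorem weakHomotopyEquivalences_slice_graft {κ : (Fin m ⊕ Fin n) × Fin 2 → P.Col}
    {e : ∀ l, (⟨κ (l, 0)⟩ : SCat.PiZero P.underlying) ≅ ⟨κ (l, 1)⟩} {α : (P.legs κ) _⦋0⦌}
    (hα : Represents κ e α) :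
    SSet.weakHomotopyEquivalences (SSet.slice (P.graft κ) α) := by
  obtain ⟨x, y, rfl⟩ : ∃ x y, κ = colors x y :=
    ⟨fun l => κ (l, 0), fun l => κ (l, 1), by ext ⟨l, j⟩; fin_cases j <;> rfl⟩
  obtain ⟨β, hβ⟩ := exists_represents (colors y x) fun l => (e l).symm
  intro Z _
  have h := mapπ₀_pre_slice_comp hα hβ Z
  have h' := mapπ₀_pre_slice_comp (e := fun l => (e l).symm) hβ hα Z
  exact Function.bijective_iff_has_inverse.2 ⟨_, congrFun h', congrFun h⟩

/-- Morphisms of simplicial `Gr`-props commute with the action of the legs of a spider. -/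
theorem map_graft {Q : SimplicialGrProp.{u, v} 𝒢} (f : P ⟶ Q)
    {κ : (Fin m ⊕ Fin n) × Fin 2 → P.Col} (α : (P.legs κ) _⦋0⦌) :
    SSet.slice (P.graft κ) α ≫ Hom.map f (endsIn κ (Fin.last 1)) (endsOut κ (Fin.last 1)) =
      Hom.map f (endsIn κ 0) (endsOut κ 0) ≫ SSet.slice (Q.graft (Hom.col f ∘ κ))
        (fun p => (Hom.map f (profIn κ (some p)) (profOut κ (some p))).app (op ⦋0⦌) (α p)) := by
  ext N x
  refine (Hom.map_comp f (spider κ) (𝒢.mem_of_isTree (spider_isTree κ)) N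
    (P.attach x ((P.legs κ).map (N.unop.const _ 0).op α))).trans ?_
  refine congrArg ((Q.comp (spider (Hom.col f ∘ κ))
    (𝒢.mem_of_isTree (spider_isTree _))).app N) (funext fun v => ?_)
  match v with
  | none => rfl
  | some p => exact NatTrans.naturality_apply (Hom.map f _ _) _ _

theorem Represents.map {Q : SimplicialGrProp.{u, v} 𝒢} (f : P ⟶ Q)
    {κ : (Fin m ⊕ Fin n) × Fin 2 → P.Col}
    {e : ∀ l, (⟨κ (l, 0)⟩ : SCat.PiZero P.underlying) ≅ ⟨κ (l, 1)⟩} {α : (P.legs κ) _⦋0⦌}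
    (hα : Represents κ e α) :
    Represents (P := Q) (Hom.col f ∘ κ)
      (fun l => (SCat.piZeroMap (forget.map f)).mapIso (e l))
      (fun p => (Hom.map f (profIn κ (some p)) (profOut κ (some p))).app (op ⦋0⦌) (α p)) :=
  ⟨fun i => congrArg (SSet.mapπ₀ (Hom.map f (Profile.single (κ (.inl i, 1)))
    (Profile.single (κ (.inl i, 0))))) (hα.1 i),
    fun i => congrArg (SSet.mapπ₀ (Hom.map f (Profile.single (κ (.inr i, 0)))
    (Profile.single (κ (.inr i, 1))))) (hα.2 i)⟩

/-- Whether `f` is a weak homotopy equivalence at a biprofile depends only on the isomorphism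
classes of its colors in the category of components. -/
theorem weakHomotopyEquivalences_map_of_iso {Q : SimplicialGrProp.{u, v} 𝒢} (f : P ⟶ Q)
    (κ : (Fin m ⊕ Fin n) × Fin 2 → P.Col)
    (e : ∀ l, (⟨κ (l, 0)⟩ : SCat.PiZero P.underlying) ≅ ⟨κ (l, 1)⟩)
    (h : SSet.weakHomotopyEquivalences (Hom.map f (endsIn κ 1) (endsOut κ 1))) :
    SSet.weakHomotopyEquivalences (Hom.map f (endsIn κ 0) (endsOut κ 0)) := by
  obtain ⟨α, hα⟩ := exists_represents κ e
  have hw := SSet.weakHomotopyEquivalences_comp (weakHomotopyEquivalences_slice_graft hα) h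
  have hw' := weakHomotopyEquivalences_slice_graft (hα.map f)
  exact SSet.weakHomotopyEquivalences_of_postcomp hw' (map_graft f α ▸ hw)

/-- Weak equivalences can be cancelled on the left: every biprofile of `Q` has colors isomorphic to
those of a biprofile in the image of `g`, where two-out-of-three applies. -/
theorem weakEquivalences_of_precomp {P Q R : SimplicialGrProp.{u, v} 𝒢} {g : P ⟶ Q} {f : Q ⟶ R}
    (hg : weakEquivalences 𝒢 g) (hgf : weakEquivalences 𝒢 (g ≫ f)) : weakEquivalences 𝒢 f := by
  rw [weakEquivalences_iff] at hg hgf ⊢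
  have hg' := hg.2
  have hgf' := hgf.2
  rw [Functor.map_comp, SCat.piZeroMap_comp] at hgf'
  refine ⟨fun c d => ?_, Functor.isEquivalence_of_comp_left (SCat.piZeroMap (forget.map g)) _⟩
  have hex (a : Q.Col) : ∃ b : P.Col,
      Nonempty ((⟨a⟩ : SCat.PiZero Q.underlying) ≅ ⟨Hom.col g b⟩) :=
    ⟨((SCat.piZeroMap (forget.map g)).objPreimage ⟨a⟩).as,
      ⟨((SCat.piZeroMap (forget.map g)).objObjPreimageIso ⟨a⟩).symm⟩⟩
  choose b hb using hex
  let κ : (Fin c.len ⊕ Fin d.len) × Fin 2 → Q.Col :=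
    fun e => ![Sum.elim c.col d.col e.1, Hom.col g (b (Sum.elim c.col d.col e.1))] e.2
  exact weakHomotopyEquivalences_map_of_iso f κ (fun l => (hb _).some)
    (SSet.weakHomotopyEquivalences_of_precomp
      (hg.1 ⟨c.len, fun i => b (c.col i)⟩ ⟨d.len, fun i => b (d.col i)⟩)
      (hgf.1 ⟨c.len, fun i => b (c.col i)⟩ ⟨d.len, fun i => b (d.col i)⟩))

end SimplicialGrProp

/-- For each of the three graph groupoids `Gr` (all, connected, or simply connected directed graphs
without directed cycles), the class `W` of weak equivalences of simplicial `Gr`-props contains `f` as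
soon as it contains `g` and `g ≫ f`; it has the two-out-of-three property and is stable under
retracts. The class of local equivalences does not have the two-out-of-three property. -/
theorem mainTheorem4 (𝒢 : GraphGroupoid) :
    (∀ (P Q R : SimplicialGrProp.{u, v} 𝒢) (g : P ⟶ Q) (f : Q ⟶ R),
      SimplicialGrProp.weakEquivalences 𝒢 g → SimplicialGrProp.weakEquivalences 𝒢 (g ≫ f) →
        SimplicialGrProp.weakEquivalences 𝒢 f) ∧
    (SimplicialGrProp.weakEquivalences.{u, v} 𝒢).HasTwoOutOfThreeProperty ∧
    (SimplicialGrProp.weakEquivalences.{u, v} 𝒢).IsStableUnderRetracts ∧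
    ¬ (SimplicialGrProp.localEquivalences.{u, v} 𝒢).HasTwoOutOfThreeProperty :=
  ⟨fun _ _ _ _ _ => SimplicialGrProp.weakEquivalences_of_precomp,
    { comp_mem := fun _ _ => SimplicialGrProp.weakEquivalences_comp
      of_postcomp := fun _ _ => SimplicialGrProp.weakEquivalences_of_postcomp
      of_precomp := fun _ _ => SimplicialGrProp.weakEquivalences_of_precomp },
    ⟨SimplicialGrProp.weakEquivalences_of_retract⟩,
    SimplicialGrProp.not_hasTwoOutOfThreeProperty_localEquivalences 𝒢⟩
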